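/- For $f\in L^2(\mathbb R)=L^2(\mathbb R;\mathbb C)$ let $\hat f$ be its Fourier transform, normalized by $\hat f(\xi)=\int_{\mathbb R}e^{-i\xi x}f(x)\,dx$, and for $s,r>0$ let $\mathcal Z_{s,r}=H^s(\mathbb R)\cap L^2(\langle x\rangle^{2r}dx)$, where $\langle x\rangle=(1+x^2)^{1/2}$, with norm $\|f\|_{\mathcal Z_{s,r}}^2=\|\langle\xi\rangle^s\hat f\|_{L^2}^2+\|\langle x\rangle^r f\|_{L^2}^2$. Let $\mathcal H$ and $D^{\alpha}$ be the Fourier multipliers with symbols $-i\,\mathrm{sgn}(\xi)$ and $|\xi|^{\alpha}$. **Theorem 1.2.** Let $a\in(0,1]$ and let $u\in C([0,T];\mathcal Z_{1,1})$ be a solution of the initial value problem for the dissipative Benjamin–Ono equation $$u_t+\mathcal H\partial_x^2u+D^{1+a}u+uu_x=0,\quad x\in\mathbb R,\ t>0,\qquad u(x,0)=\phi(x)$$ on $[0,T]$, where for every $t\in(0,T)$ the equation is understood in the sense of tempered distributions in $x$: for every Schwartz function $\eta$ the function $\tau\mapsto\int_{\mathbb R} u(x,\tau)\eta(x)\,dx$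 is differentiable at $t$, with derivative $-\langle \mathcal H\partial_x^2u(t)+D^{1+a}u(t)+\tfrac12\partial_x(u(t)^2),\eta\rangle$. If there exist two different times $t_1,t_2\in[0,T]$ such that $u(t_j)\in\mathcal Z_{3/2+a,\,3/2+a}$ for $j=1,2$, then $u(t)$ is integrable and $$\hat u(0,t)=\int_{\mathbb R}u(x,t)\,dx=0\qquad\text{for all } t\in[0,T].$$ -/

import Mathlib

open MeasureTheory Filter Topology
open scoped FourierTransform SchwartzMap ENNReal

noncomputable section

namespace DBO

/-- The complex Hilbert space `L²(ℝ)`. -/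
abbrev L2 : Type := Lp ℂ 2 (volume : Measure ℝ)

/-- The Fourier transform on `L²(ℝ)` in the normalization `∫ e^{-iξx} f(x) dx`; Mathlib's `𝓕`
uses `e^{-2πiξx}`, whence the rescaling. -/
def fourierL2 (f : L2) (ξ : ℝ) : ℂ := (𝓕 f : L2) (ξ / (2 * Real.pi))

/-- The pointwise Fourier transform `∫ e^{-iξx} f(x) dx` of an integrable function. -/
def fourierAt (f : ℝ → ℂ) (ξ : ℝ) : ℂ := ∫ x : ℝ, Complex.exp (-Complex.I * ξ * x) * f x

/-- The Japanese bracket to the power `s`: `⟨x⟩^s = (1 + x²)^{s/2}`. -/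
def bracket (s x : ℝ) : ℝ := (1 + x ^ 2) ^ (s / 2)

/-- The (extended) Sobolev norm `‖⟨ξ⟩^s f̂‖_{L²}`; it is finite iff `f ∈ H^s(ℝ)`. -/
def sobolevENorm (s : ℝ) (f : L2) : ℝ≥0∞ :=
  eLpNorm (fun ξ : ℝ => (bracket s ξ : ℂ) * fourierL2 f ξ) 2 volume

/-- The (extended) weighted norm `‖⟨x⟩^r f‖_{L²}`; it is finite iff `f ∈ L²(⟨x⟩^{2r} dx)`. -/
def weightedENorm (r : ℝ) (f : L2) : ℝ≥0∞ :=
  eLpNorm (fun x : ℝ => (bracket r x : ℂ) * f x) 2 volume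

/-- The (extended) norm of `Z_{s,r} = H^s(ℝ) ∩ L²(⟨x⟩^{2r} dx)`, `s, r ≥ 0`. -/
def zENorm (s r : ℝ) (f : L2) : ℝ≥0∞ :=
  (sobolevENorm s f ^ 2 + weightedENorm r f ^ 2) ^ (1 / 2 : ℝ)

/-- The weighted Sobolev space `Z_{s,r} = H^s(ℝ) ∩ L²(⟨x⟩^{2r} dx)`, for `s, r ≥ 0`. -/
def Z (s r : ℝ) : Set L2 := {f | sobolevENorm s f < ∞ ∧ weightedENorm r f < ∞}

/-- `u ∈ C([0,T]; Z_{s,r})`, with continuity for the norm of `Z_{s,r}`. -/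
def ContinuousInZ (s r T : ℝ) (u : ℝ → L2) : Prop :=
  ∀ t ∈ Set.Icc 0 T, u t ∈ Z s r ∧
    Tendsto (fun τ => zENorm s r (u τ - u t)) (𝓝[Set.Icc 0 T] t) (𝓝 0)

/-- The action on a Schwartz function `φ` of the tempered distribution `(σ f̂)^∨`, the Fourier
multiplier with (measurable, polynomially bounded) symbol `σ` applied to `f ∈ L²(ℝ)`. The symbol is
a function of the frequency in the normalization `e^{-iξx}`. -/
def multiplierPairing (σ : ℝ → ℂ) (f : L2) (φ : 𝓢(ℝ, ℂ)) : ℂ :=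
  ∫ ξ : ℝ, σ (2 * Real.pi * ξ) * (𝓕 f : L2) ξ * (𝓕⁻ φ : 𝓢(ℝ, ℂ)) ξ

/-- The symbol `-i sgn ξ` of the Hilbert transform. -/
def hilbertSymbol (ξ : ℝ) : ℂ := -Complex.I * (Real.sign ξ : ℂ)

/-- The symbol `iξ` of `∂ₓ`. -/
def derivSymbol (ξ : ℝ) : ℂ := Complex.I * ξ

/-- The symbol `|ξ|^s` of the fractional derivative `D^s`. -/
def fracSymbol (s ξ : ℝ) : ℂ := ((|ξ| ^ s : ℝ) : ℂ)

/-- The action on a Schwartz function of `u uₓ = ½ ∂ₓ(u²)`. -/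
def nonlinearPairing (f : L2) (φ : 𝓢(ℝ, ℂ)) : ℂ :=
  -(1 / 2) * ∫ x : ℝ, f x ^ 2 * deriv (φ : ℝ → ℂ) x

/-- `u` solves on `[0,T]` the initial value problem
`u_t + H ∂ₓ² u + D^α u + u uₓ = 0`, `u(0) = φ`:
for `0 < t < T` the equation holds in the sense of tempered distributions in `x`. -/
def IsSolution (α T : ℝ) (φ : L2) (u : ℝ → L2) : Prop :=
  u 0 = φ ∧
  ∀ t ∈ Set.Ioo 0 T, ∀ η : 𝓢(ℝ, ℂ),
    HasDerivAt (fun τ => ∫ x : ℝ, u τ x * η x)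
      (-(multiplierPairing (fun ξ => hilbertSymbol ξ * derivSymbol ξ ^ 2) (u t) η
        + multiplierPairing (fracSymbol α) (u t) η
        + nonlinearPairing (u t) η)) t

end DBO

end

noncomputable section

namespace DBO

/-! Put α = 1 + a. Testing the equation against dilations k(c·) of a fixed Schwartz function and
letting c → 0+ isolates frequency zero. Because ∫ (1 + x²)|u|² is bounded uniformly in time, û(t) is
Hölder continuous at 0. Hence a multiplier homogeneous of degree p contributes c^p · (a moment of k)
· û(0,t) with error O(c^(p+1/4)) (`HomogeneousSymbol.norm_multiplierPairing_sub_le`), while the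
nonlinearity contributes O(c^(n+1)) if k' vanishes to order n ≤ 2 at 0
(`WeightBound.norm_nonlinearPairing_le`). For the Gaussian everything tends to 0, which gives
conservation of mass (`IsSolution.integral_eq`): û(0,t) is a constant J.

Integrated in time, the expansion says that ∫ (u(t₂) - u(t₁)) k(c·) equals -(t₂ - t₁) J times the
leading moment, of size c^α, up to o(c^α). But u(t₁) and u(t₂) lie in L²(⟨x⟩^(2α+1) dx), so if k is
bounded and vanishes at 0 to order m > α, each integral is itself o(c^α)
(`tendsto_integral_mul_dilate_div_rpow`). Therefore J = 0 as soon as the rescaled leading moment has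
a nonzero limit (`IsSolution.integral_eq_zero_of_tendsto`).

It remains to choose k. For a < 1 the dissipation |ξ|^α dominates, and `evenKernel`, vanishing to
order 2 > α, detects it. For a = 1 both linear terms have degree 2 and vanishing to order 3 is
needed; `oddKernel` kills the even symbol |ξ|² by parity and detects the odd symbol iξ|ξ| of the
dispersion. -/

/-! ### The Gaussian as a Schwartz function, dilations, inverse transforms. -/

theorem exists_bound_pow_mul_polynomial_mul_gaussian (P : Polynomial ℂ) (k : ℕ) :
    ∃ C : ℝ, ∀ x : ℝ, ‖x‖ ^ k * ‖P.eval (x : ℂ) * Complex.exp (-Real.pi * (x : ℂ) ^ 2)‖ ≤ C := by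
  induction P using Polynomial.induction_on' with
  | add p q hp hq =>
    obtain ⟨C, hC⟩ := hp
    obtain ⟨D, hD⟩ := hq
    refine ⟨C + D, fun x => ?_⟩
    rw [Polynomial.eval_add, add_mul]
    calc _ ≤ ‖x‖ ^ k * (_ + _) := by gcongr; exact norm_add_le _ _
      _ ≤ C + D := by rw [mul_add]; exact add_le_add (hC x) (hD x)
  | monomial n a =>
    refine ⟨‖a‖ * (1 + (k + n).factorial), fun x => ?_⟩
    have h1 : ‖Complex.exp (-Real.pi * (x : ℂ) ^ 2)‖ = Real.exp (-(Real.pi * x ^ 2)) := by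
      rw [Complex.norm_exp]; congr 1; norm_cast; ring
    rw [Polynomial.eval_monomial, norm_mul, norm_mul, h1, norm_pow, Complex.norm_real]
    have h2 : ‖x‖ ^ (k + n) ≤ (1 + (k + n).factorial) * Real.exp (Real.pi * x ^ 2) := by
      have h3 : Real.exp (x ^ 2) ≤ Real.exp (Real.pi * x ^ 2) :=
        Real.exp_le_exp.2 (by nlinarith [Real.pi_gt_three, sq_nonneg x])
      have h4 := Real.pow_div_factorial_le_exp (x ^ 2) (sq_nonneg x) (k + n)
      rw [div_le_iff₀ (by positivity)] at h4
      have h5 : (1 : ℝ) ≤ Real.exp (Real.pi * x ^ 2) := Real.one_le_exp (by positivity)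
      have h6 : ‖x‖ ^ (k + n) ≤ 1 + (x ^ 2) ^ (k + n) := by
        rw [← pow_mul, mul_comm, pow_mul, ← Real.norm_of_nonneg (sq_nonneg (x ^ (k + n))),
          norm_pow, norm_pow]
        nlinarith [sq_nonneg (‖x‖ ^ (k + n) - 1), sq_nonneg (‖x‖ ^ (k + n))]
      have h7 : (0 : ℝ) ≤ (k + n).factorial := by positivity
      nlinarith
    calc _ = ‖a‖ * (‖x‖ ^ (k + n) * Real.exp (-(Real.pi * x ^ 2))) := by ring
      _ ≤ ‖a‖ * ((1 + (k + n).factorial) * Real.exp (Real.pi * x ^ 2)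
            * Real.exp (-(Real.pi * x ^ 2))) := by gcongr
      _ = _ := by rw [mul_assoc, ← Real.exp_add, add_neg_cancel, Real.exp_zero, mul_one]

theorem hasDerivAt_gaussian (x : ℝ) :
    HasDerivAt (fun x : ℝ => Complex.exp (-Real.pi * (x : ℂ) ^ 2))
      (-2 * Real.pi * x * Complex.exp (-Real.pi * (x : ℂ) ^ 2)) x := by
  have h := (((hasDerivAt_id (x : ℂ)).pow 2).const_mul (-(Real.pi : ℂ))).cexp.comp_ofReal
  convert! h using 1
  simp
  ring

theorem iteratedDeriv_gaussian (n : ℕ) :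
    ∃ P : Polynomial ℂ, iteratedDeriv n (fun x : ℝ => Complex.exp (-Real.pi * (x : ℂ) ^ 2))
      = fun x : ℝ => P.eval (x : ℂ) * Complex.exp (-Real.pi * (x : ℂ) ^ 2) := by
  induction n with
  | zero => exact ⟨1, by simp⟩
  | succ n ih =>
    obtain ⟨P, hP⟩ := ih
    refine ⟨P.derivative + Polynomial.C (-2 * Real.pi : ℂ) * Polynomial.X * P, ?_⟩
    rw [iteratedDeriv_succ, hP]
    ext x
    refine ((P.hasDerivAt (x : ℂ)).comp_ofReal.mul (hasDerivAt_gaussian x)).deriv.trans ?_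
    simp
    ring

/-- The Gaussian `exp (-π x²)` as a Schwartz function. -/
def gaussian : 𝓢(ℝ, ℂ) where
  toFun x := Complex.exp (-Real.pi * (x : ℂ) ^ 2)
  smooth' := by
    have : ContDiff ℝ (⊤ : ℕ∞) (fun x : ℝ => (x : ℂ)) := Complex.ofRealCLM.contDiff
    fun_prop
  decay' k n := by
    obtain ⟨P, hP⟩ := iteratedDeriv_gaussian n
    obtain ⟨C, hC⟩ := exists_bound_pow_mul_polynomial_mul_gaussian P k
    refine ⟨C, fun x => ?_⟩
    rw [norm_iteratedFDeriv_eq_norm_iteratedDeriv, hP]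
    exact hC x

theorem gaussian_apply (x : ℝ) : gaussian x = Complex.exp (-Real.pi * (x : ℂ) ^ 2) := rfl

theorem gaussian_eq_ofReal (x : ℝ) : gaussian x = (Real.exp (-Real.pi * x ^ 2) : ℝ) := by
  rw [gaussian_apply]; push_cast; rfl

theorem fourier_gaussian : 𝓕 gaussian = gaussian := by
  ext x
  rw [SchwartzMap.fourier_coe]
  have h := fourier_gaussian_pi (b := 1) (by simp)
  have h2 : (gaussian : ℝ → ℂ) = fun x : ℝ => Complex.exp (-Real.pi * 1 * (x : ℂ) ^ 2) := by
    ext x; simp [gaussian_apply]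
  rw [h2, h]
  simp

theorem fourierInv_gaussian : 𝓕⁻ gaussian = gaussian := by
  conv_lhs => rw [← fourier_gaussian]
  exact FourierTransform.fourierInv_fourier_eq _

/-- The dilation `x ↦ k (c x)` of a Schwartz function. -/
def dilate (c : ℝˣ) (k : 𝓢(ℝ, ℂ)) : 𝓢(ℝ, ℂ) :=
  SchwartzMap.compCLMOfContinuousLinearEquiv ℂ (ContinuousLinearEquiv.unitsEquivAut ℝ c) k

theorem dilate_apply (c : ℝˣ) (k : 𝓢(ℝ, ℂ)) (x : ℝ) : dilate c k x = k (c * x) := by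
  simp [dilate, mul_comm]

theorem fourierInv_dilate (c : ℝˣ) (hc : 0 < (c : ℝ)) (k : 𝓢(ℝ, ℂ)) (ξ : ℝ) :
    (𝓕⁻ (dilate c k) : 𝓢(ℝ, ℂ)) ξ = ((c : ℝ) : ℂ)⁻¹ * (𝓕⁻ k : 𝓢(ℝ, ℂ)) ((c : ℝ)⁻¹ * ξ) := by
  rw [SchwartzMap.fourierInv_coe, SchwartzMap.fourierInv_coe, Real.fourierInv_eq',
    Real.fourierInv_eq']
  have h := Measure.integral_comp_mul_left (fun y : ℝ =>
    Complex.exp (↑(2 * Real.pi * inner ℝ y ((c : ℝ)⁻¹ * ξ)) * Complex.I) • k y) c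
  rw [abs_of_pos (inv_pos.2 hc)] at h
  rw [Complex.real_smul, Complex.ofReal_inv] at h
  rw [← h]
  congr 1
  ext x
  rw [dilate_apply]
  congr 5
  simp
  field_simp

theorem fourierInv_deriv_gaussian (ξ : ℝ) :
    (𝓕⁻ (SchwartzMap.derivCLM ℂ ℂ gaussian) : 𝓢(ℝ, ℂ)) ξ
      = -(2 * Real.pi * Complex.I * ξ) * gaussian ξ := by
  have h := Real.fourier_deriv gaussian.integrable gaussian.differentiable
    (SchwartzMap.derivCLM ℂ ℂ gaussian).integrable
  rw [SchwartzMap.fourierInv_coe, Real.fourierInv_eq_fourier_neg]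
  have h2 : (SchwartzMap.derivCLM ℂ ℂ gaussian : ℝ → ℂ) = deriv gaussian := by
    ext x; simp
  rw [h2, h]
  simp only
  rw [← SchwartzMap.fourier_coe, fourier_gaussian]
  simp [gaussian_apply]

/-! ### Weighted norms and integrability. -/

theorem bracket_pos (s x : ℝ) : 0 < bracket s x := by unfold bracket; positivity

theorem measurable_bracket (s : ℝ) : Measurable (bracket s) := by unfold bracket; fun_prop

theorem bracket_sq (s x : ℝ) : bracket s x ^ 2 = (1 + x ^ 2) ^ s := by
  unfold bracket
  rw [← Real.rpow_natCast, ← Real.rpow_mul (by positivity)]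
  congr 1
  push_cast
  ring

theorem memLp_weighted {r : ℝ} {f : L2} (h : weightedENorm r f < ∞) :
    MemLp (fun x : ℝ => (bracket r x : ℂ) * f x) 2 volume := by
  refine ⟨?_, h⟩
  exact (Complex.measurable_ofReal.comp (measurable_bracket r)).aestronglyMeasurable.mul
    (Lp.aestronglyMeasurable f)

theorem integrable_weighted_sq {r : ℝ} {f : L2} (h : weightedENorm r f < ∞) :
    Integrable (fun x : ℝ => (1 + x ^ 2) ^ r * ‖f x‖ ^ 2) := by
  have := (memLp_two_iff_integrable_sq_norm (memLp_weighted h).1).1 (memLp_weighted h)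
  refine this.congr (Eventually.of_forall fun x => ?_)
  simp only [norm_mul, mul_pow, Complex.norm_real, Real.norm_of_nonneg (bracket_pos r x).le,
    bracket_sq]

theorem integral_weighted_sq {r : ℝ} {f : L2} (h : weightedENorm r f < ∞) :
    ∫ x : ℝ, (1 + x ^ 2) ^ r * ‖f x‖ ^ 2 = (weightedENorm r f).toReal ^ 2 := by
  have h1 := (memLp_weighted h).eLpNorm_eq_integral_rpow_norm two_ne_zero ENNReal.ofNat_ne_top
  have h2 : ∫ x : ℝ, ‖(bracket r x : ℂ) * f x‖ ^ (2 : ℝ≥0∞).toReal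
      = ∫ x : ℝ, (1 + x ^ 2) ^ r * ‖f x‖ ^ 2 := by
    congr 1
    ext x
    rw [ENNReal.toReal_ofNat, Real.rpow_ofNat, norm_mul, mul_pow, Complex.norm_real,
      Real.norm_of_nonneg (bracket_pos r x).le, bracket_sq]
  have h3 : 0 ≤ ∫ x : ℝ, (1 + x ^ 2) ^ r * ‖f x‖ ^ 2 :=
    integral_nonneg fun x => by positivity
  rw [weightedENorm, h1, h2, ENNReal.toReal_ofReal (by positivity), ← Real.rpow_natCast,
    ← Real.rpow_mul h3]
  simp

/-- The quantity `∫ (1 + x²) |f|²` is finite and at most `M`. -/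
structure WeightBound (f : L2) (M : ℝ) : Prop where
  integrable : Integrable (fun x : ℝ => (1 + x ^ 2) * ‖f x‖ ^ 2)
  integral_le : ∫ x : ℝ, (1 + x ^ 2) * ‖f x‖ ^ 2 ≤ M

theorem weightBound_of_weightedENorm {f : L2} {W : ℝ} (h : weightedENorm 1 f ≤ ENNReal.ofReal W) :
    WeightBound f (W ^ 2) := by
  have h1 : weightedENorm 1 f < ∞ := h.trans_lt ENNReal.ofReal_lt_top
  refine ⟨by simpa using integrable_weighted_sq h1, ?_⟩
  have h2 := integral_weighted_sq h1
  simp only [Real.rpow_one] at h2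
  rw [h2]
  rcases le_total 0 W with hW | hW
  · have := ENNReal.toReal_mono ENNReal.ofReal_ne_top h
    rw [ENNReal.toReal_ofReal hW] at this
    gcongr
  · rw [ENNReal.ofReal_of_nonpos hW, nonpos_iff_eq_zero] at h
    rw [h]
    simp
    positivity

/-- AM-GM after splitting 1/8 = 1/2 - 3/8. The last term decays like |x|^(-3/2), hence is
integrable; the surplus weight (1 + x²)^(1/8) pays for Hölder exponent 1/4 of the Fourier transform.
-/
theorem rpow_mul_norm_le (x y : ℝ) :
    (1 + x ^ 2) ^ (1 / 8 : ℝ) * y ≤ (1 + x ^ 2) * y ^ 2 + (1 + ‖x‖ ^ 2) ^ (-(3 / 2 : ℝ) / 2) := by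
  rw [Real.norm_eq_abs, sq_abs]
  have hp : 0 < 1 + x ^ 2 := by positivity
  set A := (1 + x ^ 2) ^ (1 / 2 : ℝ) * y with hA
  set B := (1 + x ^ 2) ^ (-(3 / 8) : ℝ) with hB
  have h1 : (1 + x ^ 2) ^ (1 / 8 : ℝ) * y = A * B := by
    rw [hA, hB, mul_right_comm, ← Real.rpow_add hp]; norm_num
  have h2 : (1 + x ^ 2) * y ^ 2 = A ^ 2 := by
    rw [hA, mul_pow, ← Real.rpow_natCast (_ ^ _), ← Real.rpow_mul hp.le]; norm_num
  have h3 : (1 + x ^ 2) ^ (-(3 / 2 : ℝ) / 2) = B ^ 2 := by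
    rw [hB, ← Real.rpow_natCast (_ ^ _), ← Real.rpow_mul hp.le]; norm_num
  rw [h1, h2, h3]
  nlinarith [sq_nonneg (A - B), sq_nonneg A, sq_nonneg B]

/-- A bound for `∫ (1 + x²)^{1/8} |f|` when `∫ (1 + x²) |f|² ≤ M`. -/
def massBound (M : ℝ) : ℝ := M + ∫ x : ℝ, (1 + ‖x‖ ^ 2) ^ (-(3 / 2 : ℝ) / 2)

theorem integrable_tail : Integrable (fun x : ℝ => (1 + ‖x‖ ^ 2) ^ (-(3 / 2 : ℝ) / 2)) :=
  integrable_rpow_neg_one_add_norm_sq (by norm_num)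

namespace WeightBound

variable {f : L2} {M : ℝ}

theorem integrable_rpow (h : WeightBound f M) :
    Integrable (fun x : ℝ => (1 + x ^ 2) ^ (1 / 8 : ℝ) * ‖f x‖) := by
  refine (h.integrable.add integrable_tail).mono' ?_ (Eventually.of_forall fun x => ?_)
  · exact (by fun_prop : Measurable fun x : ℝ => (1 + x ^ 2) ^ (1 / 8 : ℝ)).aestronglyMeasurable.mul
      (Lp.aestronglyMeasurable f).norm
  · rw [Real.norm_of_nonneg (by positivity)]
    exact rpow_mul_norm_le x _

theorem integral_rpow_le (h : WeightBound f M) :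
    ∫ x : ℝ, (1 + x ^ 2) ^ (1 / 8 : ℝ) * ‖f x‖ ≤ massBound M := by
  calc _ ≤ ∫ x : ℝ, ((1 + x ^ 2) * ‖f x‖ ^ 2 + (1 + ‖x‖ ^ 2) ^ (-(3 / 2 : ℝ) / 2)) :=
        integral_mono h.integrable_rpow (h.integrable.add integrable_tail)
          fun x => rpow_mul_norm_le x _
    _ ≤ _ := by
        rw [integral_add h.integrable integrable_tail]
        exact add_le_add_left h.integral_le _

theorem integrable_coe (h : WeightBound f M) : Integrable (f : ℝ → ℂ) := by
  refine h.integrable_rpow.mono (Lp.aestronglyMeasurable f) (Eventually.of_forall fun x => ?_)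
  rw [norm_mul, norm_norm, Real.norm_of_nonneg (by positivity)]
  exact le_mul_of_one_le_left (norm_nonneg _)
    (Real.one_le_rpow (by nlinarith [sq_nonneg x]) (by norm_num))

theorem integral_norm_le (h : WeightBound f M) : ∫ x : ℝ, ‖f x‖ ≤ massBound M := by
  refine (integral_mono h.integrable_coe.norm h.integrable_rpow fun x => ?_).trans
    h.integral_rpow_le
  exact le_mul_of_one_le_left (norm_nonneg _)
    (Real.one_le_rpow (by nlinarith [sq_nonneg x]) (by norm_num))

end WeightBound

/-! ### The Fourier transform near the origin. -/

theorem continuous_fourier_of_integrable {f : ℝ → ℂ} (hf : Integrable f) : Continuous (𝓕 f) :=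
  VectorFourier.fourierIntegral_continuous Real.continuous_fourierChar
    (by exact continuous_inner) hf

/-- Both sides have the same integrals against test functions, since the Fourier transform can be
moved onto the test function in either setting. This gives the L² transform meaning near frequency
zero. -/
theorem fourierL2_ae_eq {f : L2} (hf : Integrable (f : ℝ → ℂ)) :
    ((𝓕 f : L2) : ℝ → ℂ) =ᵐ[volume] 𝓕 (f : ℝ → ℂ) := by
  have hc := continuous_fourier_of_integrable hf
  refine ae_eq_of_integral_contDiff_smul_eq
    ((Lp.memLp (𝓕 f : L2)).locallyIntegrable (by norm_num)) hc.locallyIntegrable ?_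
  intro g hg hgs
  have hG : ContDiff ℝ (⊤ : ℕ∞) (fun x => (g x : ℂ)) := Complex.ofRealCLM.contDiff.comp hg
  have hGs : HasCompactSupport (fun x => (g x : ℂ)) := hgs.comp_left Complex.ofReal_zero
  let G : 𝓢(ℝ, ℂ) := hGs.toSchwartzMap hG
  have hGx : ∀ x, G x = g x := fun x => rfl
  have h1 : ∫ x : ℝ, G x • (𝓕 f : L2) x = ∫ x : ℝ, (𝓕 G) x • f x := by
    have := congrArg (fun D : 𝓢'(ℝ, ℂ) => D G) (Lp.fourier_toTemperedDistribution_eq f)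
    simp only [TemperedDistribution.fourier_apply, Lp.toTemperedDistribution_apply] at this
    exact this.symm
  have h2 : ∫ ξ, 𝓕 (G : ℝ → ℂ) ξ • f ξ = ∫ x, G x • 𝓕 (f : ℝ → ℂ) x := by
    simpa using! VectorFourier.integral_fourierIntegral_smul_eq_flip (L := innerₗ ℝ)
      Real.continuous_fourierChar continuous_inner G.integrable hf
  calc _ = ∫ x : ℝ, G x • (𝓕 f : L2) x := by simp [hGx]
    _ = ∫ x, G x • 𝓕 (f : ℝ → ℂ) x := by rw [h1, ← h2]; rfl
    _ = _ := by simp [hGx]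

theorem norm_cexp_mul_I_sub_one_le (θ : ℝ) :
    ‖Complex.exp (θ * Complex.I) - 1‖ ≤ 2 * |θ| ^ (1 / 4 : ℝ) := by
  rcases le_total |θ| 1 with h | h
  · have h1 := Real.norm_exp_I_mul_ofReal_sub_one_le (x := θ)
    rw [mul_comm, Real.norm_eq_abs] at h1
    have h2 : |θ| ≤ |θ| ^ (1 / 4 : ℝ) := by
      conv_lhs => rw [← Real.rpow_one |θ|]
      exact Real.rpow_le_rpow_of_exponent_ge' (abs_nonneg _) h (by norm_num) (by norm_num)
    have := abs_nonneg θ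
    linarith
  · have h1 := norm_sub_le (Complex.exp (θ * Complex.I)) 1
    rw [Complex.norm_exp_ofReal_mul_I, norm_one] at h1
    have h2 : 1 ≤ |θ| ^ (1 / 4 : ℝ) := Real.one_le_rpow h (by norm_num)
    linarith

theorem abs_rpow_quarter_le (x : ℝ) : |x| ^ (1 / 4 : ℝ) ≤ (1 + x ^ 2) ^ (1 / 8 : ℝ) := by
  have : |x| ^ (1 / 4 : ℝ) = (x ^ 2) ^ (1 / 8 : ℝ) := by
    rw [← sq_abs, ← Real.rpow_natCast, ← Real.rpow_mul (abs_nonneg _)]; norm_num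
  rw [this]
  exact Real.rpow_le_rpow (sq_nonneg _) (by linarith) (by norm_num)

/-- The Fourier transform of `f` is Hölder continuous of exponent `1/4` at the origin. -/
theorem WeightBound.norm_fourier_sub_le {f : L2} {M : ℝ} (h : WeightBound f M) (ξ : ℝ) :
    ‖𝓕 (f : ℝ → ℂ) ξ - ∫ x, f x‖ ≤ 2 * |2 * Real.pi * ξ| ^ (1 / 4 : ℝ) * massBound M := by
  rw [Real.fourier_eq']
  have hm : AEStronglyMeasurable
      (fun v : ℝ => Complex.exp (↑(-2 * Real.pi * inner ℝ v ξ) * Complex.I)) volume := by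
    apply Continuous.aestronglyMeasurable
    fun_prop
  have hi : Integrable
      (fun v : ℝ => Complex.exp (↑(-2 * Real.pi * inner ℝ v ξ) * Complex.I) • f v) := by
    refine h.integrable_coe.mono (hm.smul (Lp.aestronglyMeasurable f)) ?_
    refine Eventually.of_forall fun x => ?_
    rw [norm_smul, Complex.norm_exp_ofReal_mul_I, one_mul]
  rw [← integral_sub hi h.integrable_coe]
  calc _ ≤ ∫ x : ℝ, 2 * |2 * Real.pi * ξ| ^ (1 / 4 : ℝ)
            * ((1 + x ^ 2) ^ (1 / 8 : ℝ) * ‖f x‖) := by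
        refine norm_integral_le_of_norm_le (h.integrable_rpow.const_mul _)
          (Eventually.of_forall fun x => ?_)
        have h1 : Complex.exp (↑(-2 * Real.pi * inner ℝ x ξ) * Complex.I) • f x - f x
            = (Complex.exp (↑(-2 * Real.pi * inner ℝ x ξ) * Complex.I) - 1) * f x := by
          rw [smul_eq_mul]; ring
        rw [h1, norm_mul, ← mul_assoc]
        gcongr
        refine (norm_cexp_mul_I_sub_one_le _).trans ?_
        have h2 : |-2 * Real.pi * inner ℝ x ξ| = |2 * Real.pi * ξ| * |x| := by
          rw [← abs_mul, ← abs_neg]; congr 1; simp; ring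
        rw [h2, Real.mul_rpow (abs_nonneg _) (abs_nonneg _), ← mul_assoc]
        exact mul_le_mul_of_nonneg_left (abs_rpow_quarter_le x) (by positivity)
    _ ≤ _ := by
        rw [integral_const_mul]
        have := h.integral_rpow_le
        gcongr

/-! ### Homogeneous multipliers at low frequency. -/

/-- `σ` is a measurable symbol, positively homogeneous of degree `p` and bounded by `|ξ|^p`. -/
structure HomogeneousSymbol (σ : ℝ → ℂ) (p : ℝ) : Prop where
  measurable : Measurable σ
  map_mul : ∀ c : ℝ, 0 < c → ∀ ξ, σ (c * ξ) = (c ^ p : ℝ) * σ ξ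
  norm_le : ∀ ξ, ‖σ ξ‖ ≤ |ξ| ^ p

theorem homogeneousSymbol_frac (p : ℝ) : HomogeneousSymbol (fracSymbol p) p where
  measurable := by
    unfold fracSymbol
    have : Measurable fun ξ : ℝ => |ξ| ^ p := by fun_prop
    exact Complex.measurable_ofReal.comp this
  map_mul c hc ξ := by
    unfold fracSymbol
    rw [abs_mul, abs_of_pos hc, Real.mul_rpow hc.le (abs_nonneg _)]
    push_cast
    rfl
  norm_le ξ := by
    unfold fracSymbol
    rw [Complex.norm_real, Real.norm_of_nonneg (by positivity)]

theorem hilbertSymbol_mul_derivSymbol_sq (ξ : ℝ) :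
    hilbertSymbol ξ * derivSymbol ξ ^ 2 = Complex.I * ((ξ * |ξ| : ℝ) : ℂ) := by
  unfold hilbertSymbol derivSymbol
  rw [mul_pow, Complex.I_sq]
  rcases lt_trichotomy ξ 0 with h | h | h
  · rw [Real.sign_of_neg h, abs_of_neg h]; push_cast; ring
  · simp [h]
  · rw [Real.sign_of_pos h, abs_of_pos h]; push_cast; ring

theorem homogeneousSymbol_hilbert :
    HomogeneousSymbol (fun ξ => hilbertSymbol ξ * derivSymbol ξ ^ 2) 2 where
  measurable := by
    simp only [hilbertSymbol_mul_derivSymbol_sq]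
    have : Measurable fun ξ : ℝ => ξ * |ξ| := by fun_prop
    exact (Complex.measurable_ofReal.comp this).const_mul _
  map_mul c hc ξ := by
    simp only [hilbertSymbol_mul_derivSymbol_sq, abs_mul, abs_of_pos hc]
    push_cast
    norm_num
    ring
  norm_le ξ := by
    rw [hilbertSymbol_mul_derivSymbol_sq, norm_mul, Complex.norm_I, one_mul, Complex.norm_real,
      norm_mul, Real.norm_eq_abs, Real.norm_eq_abs, abs_abs, Real.rpow_ofNat, sq]

theorem rpow_le_one_add_pow_three {p x : ℝ} (hp : 0 ≤ p) (hp3 : p ≤ 3) (hx : 0 ≤ x) :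
    x ^ p ≤ 1 + x ^ 3 := by
  rcases le_total x 1 with h | h
  · have := Real.rpow_le_one hx h hp
    have : 0 ≤ x ^ 3 := by positivity
    linarith
  · have := Real.rpow_le_rpow_of_exponent_le h hp3
    norm_num at this
    linarith

theorem integrable_rpow_mul_schwartz {p : ℝ} (hp : 0 ≤ p) (hp3 : p ≤ 3) (ψ : 𝓢(ℝ, ℂ)) :
    Integrable (fun η : ℝ => |2 * Real.pi * η| ^ p * ‖ψ η‖) := by
  have hi : Integrable (fun η : ℝ => ‖ψ η‖ + (2 * Real.pi) ^ 3 * (‖η‖ ^ 3 * ‖ψ η‖)) :=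
    ψ.integrable.norm.add ((ψ.integrable_pow_mul volume 3).const_mul _)
  refine hi.mono' ?_ (Eventually.of_forall fun x => ?_)
  · exact (by fun_prop : Measurable fun η : ℝ =>
      |2 * Real.pi * η| ^ p).aestronglyMeasurable.mul ψ.integrable.1.norm
  · rw [Real.norm_of_nonneg (by positivity)]
    have h := rpow_le_one_add_pow_three hp hp3 (abs_nonneg (2 * Real.pi * x))
    calc _ ≤ (1 + |2 * Real.pi * x| ^ 3) * ‖ψ x‖ := by gcongr
      _ = _ := by
        rw [abs_mul, abs_of_pos Real.two_pi_pos, mul_pow, Real.norm_eq_abs]; ring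

/-- The integral `∫ σ(2πη) (𝓕⁻ k)(η) dη`. -/
def symbolMoment (σ : ℝ → ℂ) (k : 𝓢(ℝ, ℂ)) : ℂ :=
  ∫ η : ℝ, σ (2 * Real.pi * η) * (𝓕⁻ k : 𝓢(ℝ, ℂ)) η

theorem HomogeneousSymbol.integrable_mul_schwartz {σ : ℝ → ℂ} {p : ℝ}
    (hσ : HomogeneousSymbol σ p) (hp : 0 ≤ p) (hp3 : p ≤ 3) (ψ : 𝓢(ℝ, ℂ)) :
    Integrable (fun η : ℝ => σ (2 * Real.pi * η) * ψ η) := by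
  refine (integrable_rpow_mul_schwartz hp hp3 ψ).mono' ?_ (Eventually.of_forall fun x => ?_)
  · exact (hσ.measurable.comp (by fun_prop)).aestronglyMeasurable.mul ψ.integrable.1
  · rw [norm_mul]
    gcongr
    exact hσ.norm_le _

theorem integral_inv_mul_comp (c : ℝ) (hc : 0 < c) (h : ℝ → ℂ) :
    ∫ ξ : ℝ, (c : ℂ)⁻¹ * h (c⁻¹ * ξ) = ∫ η, h η := by
  rw [integral_const_mul, Measure.integral_comp_mul_left, inv_inv, abs_of_pos hc,
    Complex.real_smul, ← mul_assoc, inv_mul_cancel₀ (by exact_mod_cast hc.ne'), one_mul]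

theorem HomogeneousSymbol.symbolMoment_dilate {σ : ℝ → ℂ} {p : ℝ} (hσ : HomogeneousSymbol σ p)
    (c : ℝˣ) (hc : 0 < (c : ℝ)) (k : 𝓢(ℝ, ℂ)) :
    symbolMoment σ (dilate c k) = ((c : ℝ) ^ p : ℝ) * symbolMoment σ k := by
  unfold symbolMoment
  rw [← integral_const_mul, ← integral_inv_mul_comp c hc fun η =>
    ((c : ℝ) ^ p : ℝ) * (σ (2 * Real.pi * η) * (𝓕⁻ k : 𝓢(ℝ, ℂ)) η)]
  congr 1
  ext ξ
  rw [fourierInv_dilate c hc, ← mul_assoc (_ : ℂ) (σ _), ← hσ.map_mul _ hc]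
  have : (c : ℝ) * (2 * Real.pi * ((c : ℝ)⁻¹ * ξ)) = 2 * Real.pi * ξ := by field_simp
  rw [this]
  ring

theorem HomogeneousSymbol.symbolMoment_sub_smul {σ : ℝ → ℂ} {p : ℝ} (hσ : HomogeneousSymbol σ p)
    (hp : 0 ≤ p) (hp3 : p ≤ 3) (k l : 𝓢(ℝ, ℂ)) (z : ℂ) :
    symbolMoment σ (k - z • l) = symbolMoment σ k - z * symbolMoment σ l := by
  unfold symbolMoment
  rw [← integral_const_mul, ← integral_sub (hσ.integrable_mul_schwartz hp hp3 _)
    ((hσ.integrable_mul_schwartz hp hp3 _).const_mul z)]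
  congr 1
  ext ξ
  have : (𝓕⁻ (k - z • l) : 𝓢(ℝ, ℂ)) = 𝓕⁻ k - z • 𝓕⁻ l := by
    simp [sub_eq_add_neg, ← neg_smul, FourierTransform.fourierInv_add,
      FourierTransform.fourierInv_smul]
  rw [this]
  simp
  ring

/-- Low frequency asymptotics of a homogeneous Fourier multiplier. -/
theorem HomogeneousSymbol.norm_multiplierPairing_sub_le {σ : ℝ → ℂ} {p : ℝ}
    (hσ : HomogeneousSymbol σ p) (hp : 0 ≤ p) (hp2 : p ≤ 2) (k : 𝓢(ℝ, ℂ)) {f : L2} {M : ℝ}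
    (h : WeightBound f M) (c : ℝˣ) (hc : 0 < (c : ℝ)) :
    ‖multiplierPairing σ f (dilate c k)
        - ((c : ℝ) ^ p : ℝ) * symbolMoment σ k * ∫ x, f x‖
      ≤ (c : ℝ) ^ (p + 1 / 4) * (massBound M
        * (2 * ∫ η : ℝ, |2 * Real.pi * η| ^ (p + 1 / 4) * ‖(𝓕⁻ k : 𝓢(ℝ, ℂ)) η‖)) := by
  set ψ : 𝓢(ℝ, ℂ) := 𝓕⁻ k with hψ
  have hcf := continuous_fourier_of_integrable h.integrable_coe
  -- Substituting ξ = cη turns the dilation into the factor c^p and evaluates the transform of f at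
  -- cη → 0.
  have h1 : multiplierPairing σ f (dilate c k)
      = ∫ η : ℝ, ((c : ℝ) ^ p : ℝ) * (σ (2 * Real.pi * η) * ψ η) * 𝓕 (f : ℝ → ℂ) (c * η) := by
    unfold multiplierPairing
    rw [← integral_inv_mul_comp c hc fun η =>
      ((c : ℝ) ^ p : ℝ) * (σ (2 * Real.pi * η) * ψ η) * 𝓕 (f : ℝ → ℂ) (c * η)]
    apply integral_congr_ae
    filter_upwards [fourierL2_ae_eq h.integrable_coe] with ξ hξ
    rw [hξ, fourierInv_dilate c hc, ← mul_assoc (_ : ℂ) (σ _), ← hσ.map_mul _ hc]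
    have e1 : (c : ℝ) * (2 * Real.pi * ((c : ℝ)⁻¹ * ξ)) = 2 * Real.pi * ξ := by field_simp
    have e2 : (c : ℝ) * ((c : ℝ)⁻¹ * ξ) = ξ := by field_simp
    rw [e1, e2]
    ring
  have hσi := hσ.integrable_mul_schwartz hp (by linarith) ψ
  have hi : Integrable (fun η : ℝ =>
      ((c : ℝ) ^ p : ℝ) * (σ (2 * Real.pi * η) * ψ η) * 𝓕 (f : ℝ → ℂ) (c * η)) := by
    refine (hσi.const_mul _).mul_bdd (c := ∫ x, ‖f x‖)
      (hcf.comp (by fun_prop)).aestronglyMeasurable (Eventually.of_forall fun η => ?_)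
    exact VectorFourier.norm_fourierIntegral_le_integral_norm _ _ _ _ _
  have h0 := h.norm_fourier_sub_le
  rw [h1]
  unfold symbolMoment
  -- The mass is made opaque so that the rewrites below act only on the η-integrals.
  generalize (∫ x, f x) = I at *
  rw [← integral_const_mul, ← integral_mul_const, ← integral_sub hi]
  swap
  · exact (hσi.const_mul _).mul_const _
  refine (norm_integral_le_of_norm_le (g := fun η : ℝ => (c : ℝ) ^ (p + 1 / 4) * (massBound M
        * (2 * (|2 * Real.pi * η| ^ (p + 1 / 4) * ‖ψ η‖))))
    ((((integrable_rpow_mul_schwartz (by linarith) (by linarith) ψ).const_mul _).const_mul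
      _).const_mul _) (Eventually.of_forall fun η => ?_)).trans_eq ?_
  · rw [← mul_sub, norm_mul, norm_mul, norm_mul, Complex.norm_real,
      Real.norm_of_nonneg (by positivity)]
    have h2 := h0 (c * η)
    have h3 : |2 * Real.pi * (c * η)| = c * |2 * Real.pi * η| := by
      rw [mul_left_comm, abs_mul, abs_of_pos hc]
    rw [h3, Real.mul_rpow hc.le (abs_nonneg _)] at h2
    calc _ ≤ (c : ℝ) ^ p * (|2 * Real.pi * η| ^ p * ‖ψ η‖)
          * (2 * ((c : ℝ) ^ (1 / 4 : ℝ) * |2 * Real.pi * η| ^ (1 / 4 : ℝ)) * massBound M) := by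
          gcongr
          exact hσ.norm_le _
      _ = _ := by
        rw [Real.rpow_add hc, Real.rpow_add_of_nonneg (abs_nonneg _) hp (by norm_num)]; ring
  · simp only [integral_const_mul]

/-! ### The nonlinear term. -/

theorem deriv_dilate (c : ℝˣ) (k : 𝓢(ℝ, ℂ)) (x : ℝ) :
    deriv (dilate c k) x = (c : ℝ) * deriv k (c * x) := by
  have h : (dilate c k : ℝ → ℂ) = fun x => k (c * x) := funext (dilate_apply c k)
  rw [h, deriv_comp_mul_left, Complex.real_smul]

theorem WeightBound.norm_nonlinearPairing_le {f : L2} {M : ℝ} (h : WeightBound f M)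
    (k : 𝓢(ℝ, ℂ)) {n : ℕ} (hn : n ≤ 2) {C : ℝ} (hC : 0 ≤ C)
    (hk : ∀ y, ‖deriv k y‖ ≤ C * |y| ^ n) (c : ℝˣ) (hc : 0 < (c : ℝ)) :
    ‖nonlinearPairing f (dilate c k)‖ ≤ (c : ℝ) ^ (n + 1) * (C * M) := by
  unfold nonlinearPairing
  have h1 : ‖∫ x : ℝ, f x ^ 2 * deriv (dilate c k) x‖
      ≤ ∫ x : ℝ, (c : ℝ) ^ (n + 1) * C * ((1 + x ^ 2) * ‖f x‖ ^ 2) := by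
    refine norm_integral_le_of_norm_le (h.integrable.const_mul _)
      (Eventually.of_forall fun x => ?_)
    rw [deriv_dilate, norm_mul, norm_mul, norm_pow, Complex.norm_real,
      Real.norm_of_nonneg hc.le]
    have h2 := hk (c * x)
    rw [abs_mul, abs_of_pos hc, mul_pow] at h2
    -- The available weight 1 + x² is what limits n to 2.
    have h3 : |x| ^ n ≤ 1 + x ^ 2 := by
      rw [← sq_abs x]
      have := abs_nonneg x
      interval_cases n <;> nlinarith [sq_nonneg (|x| - 1)]
    calc _ ≤ ‖f x‖ ^ 2 * (c * (C * ((c : ℝ) ^ n * (1 + x ^ 2)))) := by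
          gcongr
          exact h2.trans (by gcongr)
      _ = _ := by ring
  rw [integral_const_mul] at h1
  rw [norm_mul]
  have h4 : ‖(-(1 / 2) : ℂ)‖ ≤ 1 := by norm_num
  calc _ ≤ 1 * ((c : ℝ) ^ (n + 1) * C * ∫ x : ℝ, (1 + x ^ 2) * ‖f x‖ ^ 2) := by gcongr
    _ ≤ 1 * ((c : ℝ) ^ (n + 1) * C * M) := by gcongr; exact h.integral_le
    _ = _ := by ring

/-! ### Uniform bounds and continuity in time. -/

theorem weightedENorm_le_zENorm (s r : ℝ) (f : L2) : weightedENorm r f ≤ zENorm s r f := by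
  unfold zENorm
  calc _ = (weightedENorm r f ^ (2 : ℝ)) ^ (1 / 2 : ℝ) := by
        rw [← ENNReal.rpow_mul]; norm_num
    _ ≤ _ := by
        gcongr
        rw [ENNReal.rpow_ofNat]
        exact le_add_self

theorem eLpNorm_le_weightedENorm {r : ℝ} (hr : 0 ≤ r) (f : L2) :
    eLpNorm f 2 volume ≤ weightedENorm r f := by
  refine eLpNorm_mono fun x => ?_
  rw [norm_mul, Complex.norm_real, Real.norm_of_nonneg (bracket_pos r x).le]
  refine le_mul_of_one_le_left (norm_nonneg _) (Real.one_le_rpow ?_ (by positivity))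
  nlinarith [sq_nonneg x]

theorem weightedENorm_le_sub_add (r : ℝ) (f g : L2) :
    weightedENorm r f ≤ weightedENorm r (f - g) + weightedENorm r g := by
  have hm : AEStronglyMeasurable (fun x : ℝ => (bracket r x : ℂ)) volume :=
    (Complex.measurable_ofReal.comp (measurable_bracket r)).aestronglyMeasurable
  refine le_trans (eLpNorm_congr_ae ?_).le (eLpNorm_add_le
    (hm.mul (Lp.aestronglyMeasurable (f - g))) (hm.mul (Lp.aestronglyMeasurable g)) one_le_two)
  filter_upwards [Lp.coeFn_sub f g] with x hx
  simp only [Pi.add_apply, hx, Pi.sub_apply]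
  ring

namespace ContinuousInZ

variable {s r T : ℝ} {u : ℝ → L2}

theorem continuousOn (hu : ContinuousInZ s r T u) (hr : 0 ≤ r) :
    ContinuousOn u (Set.Icc 0 T) := by
  intro t ht
  rw [ContinuousWithinAt, tendsto_iff_edist_tendsto_0]
  refine tendsto_of_tendsto_of_tendsto_of_le_of_le tendsto_const_nhds (hu t ht).2
    (fun _ => zero_le) fun τ => ?_
  rw [edist_eq_enorm_sub, Lp.enorm_def]
  exact (eLpNorm_le_weightedENorm hr _).trans (weightedENorm_le_zENorm s r _)

theorem exists_bound (hu : ContinuousInZ s r T u) :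
    ∃ W : ℝ, ∀ t ∈ Set.Icc 0 T, weightedENorm r (u t) ≤ ENNReal.ofReal W := by
  refine isCompact_Icc.induction_on
    (p := fun S => ∃ W : ℝ, ∀ t ∈ S, weightedENorm r (u t) ≤ ENNReal.ofReal W) ?_ ?_ ?_ ?_
  · exact ⟨0, by simp⟩
  · rintro S S' hS ⟨W, hW⟩
    exact ⟨W, fun t ht => hW t (hS ht)⟩
  · rintro S S' ⟨W, hW⟩ ⟨W', hW'⟩
    refine ⟨max W W', fun t ht => ?_⟩
    rcases ht with ht | ht
    · exact (hW t ht).trans (ENNReal.ofReal_le_ofReal (le_max_left _ _))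
    · exact (hW' t ht).trans (ENNReal.ofReal_le_ofReal (le_max_right _ _))
  · intro t ht
    refine ⟨_, (hu t ht).2.eventually_le_const (u := 1) zero_lt_one,
      (1 + weightedENorm r (u t)).toReal, fun τ hτ => ?_⟩
    rw [ENNReal.ofReal_toReal (ENNReal.add_ne_top.2 ⟨ENNReal.one_ne_top, (hu t ht).1.2.ne⟩)]
    exact (weightedENorm_le_sub_add r _ (u t)).trans
      (add_le_add_left ((weightedENorm_le_zENorm s r _).trans hτ) _)

theorem exists_weightBound (hu : ContinuousInZ s 1 T u) :
    ∃ M : ℝ, ∀ t ∈ Set.Icc 0 T, WeightBound (u t) M := by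
  obtain ⟨W, hW⟩ := hu.exists_bound
  exact ⟨W ^ 2, fun t ht => weightBound_of_weightedENorm (hW t ht)⟩

end ContinuousInZ

theorem continuous_integral_mul_schwartz (η : 𝓢(ℝ, ℂ)) :
    Continuous fun f : L2 => ∫ x : ℝ, f x * η x := by
  have h : (fun f : L2 => ∫ x : ℝ, f x * η x)
      = fun f : L2 => (Lp.toTemperedDistributionCLM ℂ volume 2 f : 𝓢'(ℝ, ℂ)) η := by
    ext f
    rw [Lp.toTemperedDistributionCLM_apply, Lp.toTemperedDistribution_apply]
    simp [mul_comm]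
  rw [h]
  exact (PointwiseConvergenceCLM.evalCLM _ _ η).continuous.comp
    (Lp.toTemperedDistributionCLM ℂ volume 2).continuous

/-- The mean value inequality on the open interval gives a Lipschitz bound, which continuity extends
to the closure. The endpoints matter because t₁ or t₂ may be 0 or T, where no equation is assumed.
-/
theorem norm_sub_le_of_hasDerivAt_Ioo {F F' : ℝ → ℂ} {T C : ℝ}
    (hc : ContinuousOn F (Set.Icc 0 T)) (hd : ∀ t ∈ Set.Ioo 0 T, HasDerivAt F (F' t) t)
    (hC : ∀ t ∈ Set.Ioo 0 T, ‖F' t‖ ≤ C) {s t : ℝ} (hs : s ∈ Set.Icc 0 T)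
    (ht : t ∈ Set.Icc 0 T) : ‖F t - F s‖ ≤ C * |t - s| := by
  rcases eq_or_ne s t with rfl | hst
  · simp
  have hT : 0 < T := by
    rcases lt_or_gt_of_ne hst with h | h
    · linarith [hs.1, ht.2]
    · linarith [ht.1, hs.2]
  have hC0 : 0 ≤ C := (norm_nonneg _).trans (hC (T / 2) ⟨by linarith, by linarith⟩)
  have hl : LipschitzOnWith C.toNNReal F (Set.Ioo 0 T) := by
    refine LipschitzOnWith.of_dist_le_mul fun x hx y hy => ?_
    rw [dist_eq_norm, dist_eq_norm, Real.coe_toNNReal _ hC0]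
    exact Convex.norm_image_sub_le_of_norm_hasDerivWithin_le
      (fun z hz => (hd z hz).hasDerivWithinAt) hC (convex_Ioo 0 T) hy hx
  have hcl := closure_Ioo hT.ne
  have h2 := (hl.closure (by rwa [hcl])).dist_le_mul t (by rwa [hcl]) s (by rwa [hcl])
  rwa [dist_eq_norm, Real.dist_eq, Real.coe_toNNReal _ hC0] at h2

/-! ### Decay of weighted functions tested against dilations. -/

theorem integrable_comp_abs_of_integrableOn_Ioi {h : ℝ → ℝ} (hh : IntegrableOn h (Set.Ioi 0)) :
    Integrable (fun x => h |x|) := by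
  have hf : IntegrableOn (fun x => h |x|) (Set.Ioi 0) :=
    hh.congr_fun (fun x hx => by rw [abs_of_pos hx]) measurableSet_Ioi
  have hn : IntegrableOn (fun x ↦ h |x|) (Set.Iic 0) := by
    rw [← Measure.map_neg_eq_self (volume : Measure ℝ)]
    let m : MeasurableEmbedding fun x : ℝ => -x := (Homeomorph.neg ℝ).measurableEmbedding
    rw [m.integrableOn_map_iff]
    simp_rw [Function.comp_def, abs_neg, Set.neg_preimage, Set.neg_Iic, neg_zero]
    exact (integrableOn_Ici_iff_integrableOn_Ioi).2 hf
  rw [← integrableOn_univ, ← Set.Iic_union_Ioi (a := (0 : ℝ))]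
  exact hn.union hf

theorem integrableOn_Ioi_min_rpow {p q C D : ℝ} (hp : -1 < p) (hq : q < -1) :
    IntegrableOn (fun x : ℝ => if x ≤ 1 then C * x ^ p else D * x ^ q) (Set.Ioi 0) := by
  rw [← Set.Ioc_union_Ioi_eq_Ioi zero_le_one]
  refine IntegrableOn.union ?_ ?_
  · have h1 : IntegrableOn (fun x : ℝ => C * x ^ p) (Set.Ioc 0 1) :=
      ((intervalIntegral.intervalIntegrable_rpow' hp).1).const_mul C
    exact h1.congr_fun (fun x hx => by simp [hx.2]) measurableSet_Ioc
  · have h1 : IntegrableOn (fun x : ℝ => D * x ^ q) (Set.Ioi 1) :=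
      (integrableOn_Ioi_rpow_of_lt hq one_pos).const_mul D
    exact h1.congr_fun (fun x hx => by simp [not_le.2 (Set.mem_Ioi.1 hx)]) measurableSet_Ioi

/-- The square is O(|y|^(2m-2α-1)) near 0, integrable because m > α, and O(|y|^(-2α-1)) at infinity,
integrable because α > 0. -/
theorem integrable_sq_mul_rpow_of_vanishing {k : ℝ → ℂ} (hk : Continuous k) {m C D α : ℝ}
    (hα : 0 < α) (hm : α < m) (hC : ∀ y, ‖k y‖ ≤ C * |y| ^ m) (hD : ∀ y, ‖k y‖ ≤ D) :
    Integrable (fun y : ℝ => (‖k y‖ * |y| ^ (-α - 1 / 2)) ^ 2) := by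
  refine (integrable_comp_abs_of_integrableOn_Ioi (integrableOn_Ioi_min_rpow (C := C ^ 2)
    (D := D ^ 2) (p := 2 * m - 2 * α - 1) (q := -2 * α - 1) (by linarith) (by linarith))).mono' ?_ ?_
  · have : Measurable fun y : ℝ => |y| ^ (-α - 1 / 2) := by fun_prop
    exact ((hk.measurable.norm.mul this).pow_const 2).aestronglyMeasurable
  · filter_upwards [compl_mem_ae_iff.2 (measure_singleton (0 : ℝ))] with y hy
    have hy0 : 0 < |y| := abs_pos.2 hy
    rw [Real.norm_of_nonneg (sq_nonneg _), mul_pow, ← Real.rpow_natCast (|y| ^ _),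
      ← Real.rpow_mul hy0.le]
    split_ifs with h
    · have e1 : |y| ^ (2 * m - 2 * α - 1) = (|y| ^ m) ^ 2 * |y| ^ ((-α - 1 / 2) * (2 : ℕ)) := by
        rw [← Real.rpow_natCast (|y| ^ _), ← Real.rpow_mul hy0.le, ← Real.rpow_add hy0]
        congr 1; push_cast; ring
      rw [e1, ← mul_assoc, ← mul_pow]
      gcongr
      exact hC y
    · have e1 : (-α - 1 / 2) * (2 : ℕ) = -2 * α - 1 := by push_cast; ring
      rw [e1]
      gcongr
      exact hD y

theorem tendsto_rpow_nhdsGT_zero {p : ℝ} (hp : 0 < p) :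
    Tendsto (fun c : ℝ => c ^ p) (𝓝[>] 0) (𝓝 0) := by
  have h := (Real.continuousAt_rpow_const 0 p (Or.inr hp.le)).tendsto
  rw [Real.zero_rpow hp.ne'] at h
  exact h.mono_left nhdsWithin_le_nhds

theorem integral_rescaled_sq {c : ℝ} (hc : 0 < c) (W : ℝ → ℝ) :
    ∫ x : ℝ, (c ^ (1 / 2 : ℝ) * W (c * x)) ^ 2 = ∫ y, W y ^ 2 := by
  have h1 : ∀ x : ℝ, (c ^ (1 / 2 : ℝ) * W (c * x)) ^ 2 = c * W (c * x) ^ 2 := fun x => by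
    rw [mul_pow, ← Real.rpow_natCast (c ^ _), ← Real.rpow_mul hc.le]; norm_num
  simp_rw [h1]
  rw [integral_const_mul, Measure.integral_comp_mul_left (fun y => W y ^ 2),
    abs_of_pos (inv_pos.2 hc), smul_eq_mul, mul_inv_cancel_left₀ hc.ne']

/-- The `L²`-normalized dilations `c^{1/2} W(c ·)` of a square integrable function tend weakly
to zero as `c → 0+`. -/
theorem tendsto_integral_mul_rescaled {P W : ℝ → ℝ} (hPm : AEStronglyMeasurable P)
    (hP0 : ∀ x, 0 ≤ P x) (hP : Integrable fun x => P x ^ 2) (hWm : Measurable W)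
    (hW0 : ∀ x, 0 ≤ W x) (hW : Integrable fun x => W x ^ 2)
    (hlim : ∀ x, x ≠ 0 → Tendsto (fun c : ℝ => c ^ (1 / 2 : ℝ) * W (c * x)) (𝓝[>] 0) (𝓝 0)) :
    Tendsto (fun c : ℝ => ∫ x, P x * (c ^ (1 / 2 : ℝ) * W (c * x))) (𝓝[>] 0) (𝓝 0) := by
  set V : ℝ → ℝ → ℝ := fun c x => c ^ (1 / 2 : ℝ) * W (c * x) with hV
  have hVm : ∀ c, Measurable (V c) := fun c => by fun_prop
  have hV2 : ∀ c : ℝ, 0 < c → Integrable fun x => V c x ^ 2 := fun c hc => by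
    have h1 : ∀ x : ℝ, V c x ^ 2 = (c ^ (1 / 2 : ℝ)) ^ 2 * W (c * x) ^ 2 := fun x => mul_pow _ _ _
    simp_rw [h1]
    exact (hW.comp_mul_left' hc.ne').const_mul _
  have hpos : ∀ᶠ c : ℝ in 𝓝[>] 0, 0 < c := self_mem_nhdsWithin
  rw [Metric.tendsto_nhds]
  intro ε hε
  set w := ∫ y, W y ^ 2 with hw
  have hw0 : 0 ≤ w := integral_nonneg fun _ => sq_nonneg _
  -- All V c with c > 0 satisfy ∫ V² = w, so this choice makes δ ∫ V² < ε/2; the 1 covers w = 0.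
  set δ := ε / (2 * (1 + w)) with hδ
  have hδ0 : 0 < δ := by positivity
  -- The part of PV exceeding δV² is at most P²/(4δ) by completing the square, a bound independent
  -- of c, so dominated convergence applies to it.
  have hS : Tendsto (fun c => ∫ x, max (P x * V c x - δ * V c x ^ 2) 0) (𝓝[>] 0)
      (𝓝 (∫ _ : ℝ, (0 : ℝ))) := by
    refine tendsto_integral_filter_of_dominated_convergence (fun x => (4 * δ)⁻¹ * P x ^ 2)
      ?_ ?_ (hP.const_mul _) ?_
    · refine Eventually.of_forall fun c => ?_
      exact ((hPm.mul (hVm c).aestronglyMeasurable).sub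
        (((hVm c).pow_const 2).const_mul δ).aestronglyMeasurable).sup
          aestronglyMeasurable_const
    · refine Eventually.of_forall fun c => Eventually.of_forall fun x => ?_
      rw [Real.norm_of_nonneg (le_max_right _ _)]
      refine max_le ?_ (by positivity)
      rw [inv_mul_eq_div, le_div_iff₀ (by positivity)]
      nlinarith [sq_nonneg (P x - 2 * δ * V c x)]
    · filter_upwards [compl_mem_ae_iff.2 (measure_singleton (0 : ℝ))] with x hx
      have h1 := hlim x hx
      have h2 := ((h1.const_mul (P x)).sub ((h1.pow 2).const_mul δ)).max
        (tendsto_const_nhds (x := (0 : ℝ)))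
      simpa [hV] using h2
  rw [integral_zero, Metric.tendsto_nhds] at hS
  filter_upwards [hS (ε / 2) (by positivity), hpos] with c hc hc0
  have hPV : Integrable fun x => P x * V c x := by
    refine (hP.add (hV2 c hc0)).mono' (hPm.mul (hVm c).aestronglyMeasurable)
      (Eventually.of_forall fun x => ?_)
    have : 0 ≤ V c x := mul_nonneg (by positivity) (hW0 _)
    rw [Real.norm_of_nonneg (mul_nonneg (hP0 x) this)]
    simp only [Pi.add_apply]
    nlinarith [sq_nonneg (P x - V c x), sq_nonneg (P x), sq_nonneg (V c x)]
  have hSi : Integrable fun x => max (P x * V c x - δ * V c x ^ 2) 0 :=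
    (hPV.sub ((hV2 c hc0).const_mul δ)).pos_part
  have h1 : ∫ x, P x * V c x ≤ (∫ x, max (P x * V c x - δ * V c x ^ 2) 0) + δ * w := by
    rw [hw, ← integral_rescaled_sq hc0 W, ← integral_const_mul,
      ← integral_add hSi ((hV2 c hc0).const_mul δ)]
    refine integral_mono hPV (hSi.add ((hV2 c hc0).const_mul δ)) fun x => ?_
    have := le_max_left (P x * V c x - δ * V c x ^ 2) 0
    simp only [hV] at *
    linarith
  have h2 : 0 ≤ ∫ x, P x * V c x :=
    integral_nonneg fun x => mul_nonneg (hP0 x) (mul_nonneg (by positivity) (hW0 _))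
  have h3 : 0 ≤ ∫ x, max (P x * V c x - δ * V c x ^ 2) 0 :=
    integral_nonneg fun x => le_max_right _ _
  rw [Real.dist_0_eq_abs, abs_of_nonneg h3] at hc
  rw [Real.dist_0_eq_abs, abs_of_nonneg h2]
  have h4 : δ * w < ε / 2 := by
    have : δ * (1 + w) = ε / 2 := by rw [hδ]; field_simp
    nlinarith
  linarith

/-- A function in `L²(⟨x⟩^{2α+1} dx)`, tested against the dilations of a bounded function which
vanishes at the origin to an order larger than `α`, decays faster than `c^α`. -/
theorem tendsto_integral_mul_dilate_div_rpow {k : ℝ → ℂ} (hk : Continuous k) {m C D α : ℝ}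
    (hα : 0 < α) (hm : α < m) (hC : ∀ y, ‖k y‖ ≤ C * |y| ^ m) (hD : ∀ y, ‖k y‖ ≤ D) {f : L2}
    (hf : weightedENorm (α + 1 / 2) f < ∞) :
    Tendsto (fun c : ℝ => ((c ^ (-α) : ℝ) : ℂ) * ∫ x : ℝ, f x * k (c * x)) (𝓝[>] 0) (𝓝 0) := by
  set P : ℝ → ℝ := fun x => |x| ^ (α + 1 / 2) * ‖f x‖ with hPdef
  set W : ℝ → ℝ := fun y => ‖k y‖ * |y| ^ (-α - 1 / 2) with hWdef
  have hPm : AEStronglyMeasurable P :=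
    (by fun_prop : Measurable fun x : ℝ => |x| ^ (α + 1 / 2)).aestronglyMeasurable.mul
      (Lp.aestronglyMeasurable f).norm
  have hP : Integrable fun x => P x ^ 2 := by
    refine (integrable_weighted_sq hf).mono' (hPm.pow 2) (Eventually.of_forall fun x => ?_)
    rw [Real.norm_of_nonneg (sq_nonneg _), hPdef, mul_pow]
    have e1 : (|x| ^ (α + 1 / 2)) ^ 2 = (x ^ 2) ^ (α + 1 / 2) := by
      rw [← sq_abs x, ← Real.rpow_natCast, ← Real.rpow_natCast, ← Real.rpow_mul (abs_nonneg _),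
        ← Real.rpow_mul (abs_nonneg _), mul_comm]
    simp only [e1]
    gcongr
    linarith
  have hWm : Measurable W := hk.measurable.norm.mul (by fun_prop)
  -- Writing c^(-α) = c^(1/2) c^(-α-1/2) exhibits c^(-α)|f k(c·)| as P times an L²-normalized
  -- dilation of W; the powers of |x| cancel off the origin.
  have key : ∀ c : ℝ, 0 < c → ∀ x : ℝ, x ≠ 0 →
      c ^ (1 / 2 : ℝ) * W (c * x) = c ^ (-α) * ‖k (c * x)‖ * |x| ^ (-α - 1 / 2) := by
    intro c hc x hx
    simp only [hWdef]
    rw [abs_mul, abs_of_pos hc, Real.mul_rpow hc.le (abs_nonneg _)]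
    have : c ^ (-α) = c ^ (1 / 2 : ℝ) * c ^ (-α - 1 / 2) := by
      rw [← Real.rpow_add hc]; congr 1; ring
    rw [this]
    ring
  have hpos : ∀ᶠ c : ℝ in 𝓝[>] 0, 0 < c := self_mem_nhdsWithin
  have h := tendsto_integral_mul_rescaled hPm (fun x => by positivity) hP hWm
    (fun x => by positivity) (integrable_sq_mul_rpow_of_vanishing hk hα hm hC hD) (by
      intro x hx
      have h1 : Tendsto (fun c : ℝ => c ^ (m - α) * (C * |x| ^ m * |x| ^ (-α - 1 / 2)))
          (𝓝[>] 0) (𝓝 0) := by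
        simpa using (tendsto_rpow_nhdsGT_zero (sub_pos.2 hm)).mul_const
          (C * |x| ^ m * |x| ^ (-α - 1 / 2))
      refine squeeze_zero' (Eventually.mono hpos fun c hc => by positivity) ?_ h1
      filter_upwards [hpos] with c hc
      rw [key c hc x hx]
      have h2 := hC (c * x)
      rw [abs_mul, abs_of_pos hc, Real.mul_rpow hc.le (abs_nonneg _)] at h2
      calc _ ≤ c ^ (-α) * (C * (c ^ m * |x| ^ m)) * |x| ^ (-α - 1 / 2) := by gcongr
        _ = _ := by rw [sub_eq_neg_add m, Real.rpow_add hc]; ring)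
  refine squeeze_zero_norm' ?_ h
  filter_upwards [hpos] with c hc
  rw [← integral_const_mul]
  refine (norm_integral_le_integral_norm _).trans_eq (integral_congr_ae ?_)
  filter_upwards [compl_mem_ae_iff.2 (measure_singleton (0 : ℝ))] with x hx
  rw [key c hc x hx, norm_mul, norm_mul, Complex.norm_real, Real.norm_of_nonneg (by positivity)]
  have : |x| ^ (α + 1 / 2) * |x| ^ (-α - 1 / 2) = 1 := by
    rw [← Real.rpow_add (abs_pos.2 hx)]; ring_nf; exact Real.rpow_zero _
  simp only [hPdef]
  linear_combination (-(c ^ (-α)) * ‖f x‖ * ‖k (c * x)‖) * this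

/-! ### The two test kernels and their moments. -/

/-- The difference `g - g(·/2)` of the Gaussian and its dilation. -/
def evenKernel : 𝓢(ℝ, ℂ) :=
  gaussian - (1 : ℂ) • dilate (Units.mk0 (1 / 2) (by norm_num)) gaussian

/-- The difference `g' - 2 g'(·/2)`, where `g` is the Gaussian. -/
def oddKernel : 𝓢(ℝ, ℂ) :=
  SchwartzMap.derivCLM ℂ ℂ gaussian - (2 : ℂ) •
    dilate (Units.mk0 (1 / 2) (by norm_num)) (SchwartzMap.derivCLM ℂ ℂ gaussian)

theorem evenKernel_apply (x : ℝ) : evenKernel x = gaussian x - gaussian (1 / 2 * x) := by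
  simp [evenKernel, dilate_apply]

theorem deriv_gaussian (x : ℝ) : deriv gaussian x = -2 * Real.pi * x * gaussian x :=
  (hasDerivAt_gaussian x).deriv

theorem oddKernel_apply (x : ℝ) : oddKernel x = -2 * Real.pi * x * evenKernel x := by
  simp [oddKernel, dilate_apply, deriv_gaussian, evenKernel_apply]
  ring

theorem norm_gaussian_le_one (x : ℝ) : ‖gaussian x‖ ≤ 1 := by
  rw [gaussian_eq_ofReal, Complex.norm_real, Real.norm_of_nonneg (Real.exp_pos _).le,
    Real.exp_le_one_iff]
  nlinarith [Real.pi_pos, sq_nonneg x]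

theorem norm_gaussian_sub_le (x : ℝ) :
    ‖gaussian x - gaussian (1 / 2 * x)‖ ≤ Real.pi * |x| ^ 2 := by
  rw [gaussian_eq_ofReal, gaussian_eq_ofReal, ← Complex.ofReal_sub, Complex.norm_real,
    Real.norm_eq_abs, abs_sub_comm, sq_abs]
  have h0 := mul_nonneg Real.pi_pos.le (sq_nonneg x)
  have h1 : Real.exp (-Real.pi * x ^ 2) ≤ Real.exp (-Real.pi * (1 / 2 * x) ^ 2) :=
    Real.exp_le_exp.2 (by nlinarith)
  have h2 : Real.exp (-Real.pi * (1 / 2 * x) ^ 2) ≤ 1 :=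
    Real.exp_le_one_iff.2 (by nlinarith)
  have h3 := Real.add_one_le_exp (-Real.pi * x ^ 2)
  rw [abs_of_nonneg (by linarith)]
  linarith

theorem norm_evenKernel_le (x : ℝ) : ‖evenKernel x‖ ≤ Real.pi * |x| ^ 2 := by
  rw [evenKernel_apply]
  exact norm_gaussian_sub_le x

theorem norm_two_pi_mul (x : ℝ) : ‖(-2 * Real.pi * x : ℂ)‖ = 2 * Real.pi * |x| := by
  simp [abs_of_pos Real.pi_pos]

/-- The coefficient 2 in `oddKernel` cancels the linear terms at 0 and makes it -2πx times
`evenKernel`, which gains one order of vanishing. -/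
theorem norm_oddKernel_le (x : ℝ) : ‖oddKernel x‖ ≤ 2 * Real.pi ^ 2 * |x| ^ 3 := by
  rw [oddKernel_apply]
  rw [norm_mul, norm_two_pi_mul]
  calc _ ≤ 2 * Real.pi * |x| * (Real.pi * |x| ^ 2) := by gcongr; exact norm_evenKernel_le x
    _ = _ := by ring

theorem hasDerivAt_evenKernel (x : ℝ) :
    HasDerivAt evenKernel
      (-2 * Real.pi * x * (gaussian x - 1 / 4 * gaussian (1 / 2 * x))) x := by
  have h1 : HasDerivAt (fun y : ℝ => 1 / 2 * y) (1 / 2) x := by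
    simpa only [id, mul_one] using (hasDerivAt_id x).const_mul (1 / 2)
  have h2 := (hasDerivAt_gaussian x).sub ((hasDerivAt_gaussian (1 / 2 * x)).scomp x h1)
  have h3 : (evenKernel : ℝ → ℂ) = (fun x : ℝ => Complex.exp (-Real.pi * (x : ℂ) ^ 2))
      - (fun x : ℝ => Complex.exp (-Real.pi * (x : ℂ) ^ 2)) ∘ fun y : ℝ => 1 / 2 * y :=
    funext evenKernel_apply
  rw [h3]
  convert! h2 using 1
  simp only [gaussian_apply, Complex.real_smul]
  push_cast
  ring

theorem norm_deriv_evenKernel_le (x : ℝ) : ‖deriv evenKernel x‖ ≤ 4 * Real.pi * |x| ^ 1 := by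
  rw [(hasDerivAt_evenKernel x).deriv, norm_mul, norm_two_pi_mul]
  have h : ‖gaussian x - 1 / 4 * gaussian (1 / 2 * x)‖ ≤ 2 := by
    refine (norm_sub_le _ _).trans ?_
    rw [norm_mul]
    have h1 := norm_gaussian_le_one x
    have h2 := norm_gaussian_le_one (1 / 2 * x)
    norm_num at *
    linarith
  calc _ ≤ 2 * Real.pi * |x| * 2 := by gcongr
    _ = _ := by ring

theorem norm_deriv_oddKernel_le (x : ℝ) :
    ‖deriv oddKernel x‖ ≤ 10 * Real.pi ^ 2 * |x| ^ 2 := by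
  have h1 : HasDerivAt (fun y : ℝ => (-2 * Real.pi * y : ℂ)) (-2 * Real.pi) x := by
    simpa using (((hasDerivAt_id (x : ℂ)).const_mul (-2 * Real.pi : ℂ)).comp_ofReal)
  have h2 : deriv oddKernel x = -2 * Real.pi * evenKernel x
      + -2 * Real.pi * x * deriv evenKernel x := by
    have h3 : (oddKernel : ℝ → ℂ) = fun y => -2 * Real.pi * y * evenKernel y :=
      funext oddKernel_apply
    rw [h3]
    exact (h1.mul (evenKernel.differentiableAt (x := x)).hasDerivAt).deriv
  rw [h2]
  refine (norm_add_le _ _).trans ?_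
  rw [norm_mul, norm_mul (-2 * Real.pi * x : ℂ), norm_two_pi_mul]
  have h3 : ‖(-2 * Real.pi : ℂ)‖ = 2 * Real.pi := by simp [abs_of_pos Real.pi_pos]
  rw [h3]
  calc _ ≤ 2 * Real.pi * (Real.pi * |x| ^ 2) + 2 * Real.pi * |x| * (4 * Real.pi * |x| ^ 1) := by
        gcongr
        · exact norm_evenKernel_le x
        · exact norm_deriv_evenKernel_le x
    _ = _ := by ring

theorem norm_deriv_gaussian_le : ∃ C : ℝ, 0 ≤ C ∧ ∀ x, ‖deriv gaussian x‖ ≤ C * |x| ^ 0 := by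
  obtain ⟨C, hC⟩ := (SchwartzMap.derivCLM ℂ ℂ gaussian).decay 0 0
  refine ⟨C, hC.1.le, fun x => ?_⟩
  simpa using hC.2 x

theorem exists_norm_le (k : 𝓢(ℝ, ℂ)) : ∃ D : ℝ, ∀ y, ‖k y‖ ≤ D := by
  obtain ⟨D, hD⟩ := k.decay 0 0
  exact ⟨D, fun y => by simpa using hD.2 y⟩

theorem HomogeneousSymbol.symbolMoment_evenKernel {σ : ℝ → ℂ} {p : ℝ}
    (hσ : HomogeneousSymbol σ p) (hp : 0 ≤ p) (hp3 : p ≤ 3) :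
    symbolMoment σ evenKernel = (1 - ((1 / 2 : ℝ) ^ p : ℝ)) * symbolMoment σ gaussian := by
  rw [evenKernel, hσ.symbolMoment_sub_smul hp hp3, hσ.symbolMoment_dilate _ (by simp)]
  simp only [Units.val_mk0]
  ring

theorem HomogeneousSymbol.symbolMoment_oddKernel {σ : ℝ → ℂ}
    (hσ : HomogeneousSymbol σ 2) :
    symbolMoment σ oddKernel
      = 1 / 2 * symbolMoment σ (SchwartzMap.derivCLM ℂ ℂ gaussian) := by
  rw [oddKernel, hσ.symbolMoment_sub_smul (by norm_num) (by norm_num),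
    hσ.symbolMoment_dilate _ (by simp)]
  simp only [Units.val_mk0]
  norm_num
  ring

theorem symbolMoment_frac_gaussian_ne_zero {p : ℝ} (hp : 0 ≤ p) (hp3 : p ≤ 3) :
    symbolMoment (fracSymbol p) gaussian ≠ 0 := by
  have hi := integrable_rpow_mul_schwartz hp hp3 gaussian
  have h1 : symbolMoment (fracSymbol p) gaussian
      = ((∫ η : ℝ, |2 * Real.pi * η| ^ p * ‖gaussian η‖ : ℝ) : ℂ) := by
    unfold symbolMoment
    rw [fourierInv_gaussian, ← integral_complex_ofReal]
    congr 1
    ext η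
    rw [gaussian_eq_ofReal, Complex.norm_real, Real.norm_of_nonneg (Real.exp_pos _).le,
      fracSymbol]
    push_cast
    rfl
  rw [h1]
  have hcont : Continuous fun η : ℝ => |2 * Real.pi * η| ^ p * ‖gaussian η‖ :=
    (Continuous.rpow_const (by fun_prop) fun _ => Or.inr hp).mul gaussian.continuous.norm
  have h2 : 0 < ∫ η : ℝ, |2 * Real.pi * η| ^ p * ‖gaussian η‖ := by
    refine integral_pos_of_integrable_nonneg_nonzero (x := 1) hcont hi
      (fun η => by positivity) ?_
    have h3 : gaussian 1 ≠ 0 := Complex.exp_ne_zero _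
    have h4 : |2 * Real.pi * 1| ≠ 0 := by simp
    positivity
  exact_mod_cast h2.ne'

/-- The symbol iξ|ξ| times the factor -iξ coming from the derivative is |ξ|³, so the moment is that
of a positive function. -/
theorem symbolMoment_hilbert_deriv_gaussian_ne_zero :
    symbolMoment (fun ξ => hilbertSymbol ξ * derivSymbol ξ ^ 2)
      (SchwartzMap.derivCLM ℂ ℂ gaussian) ≠ 0 := by
  have h1 : symbolMoment (fun ξ => hilbertSymbol ξ * derivSymbol ξ ^ 2)
      (SchwartzMap.derivCLM ℂ ℂ gaussian) = symbolMoment (fracSymbol 3) gaussian := by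
    unfold symbolMoment
    congr 1
    ext η
    beta_reduce
    rw [fourierInv_gaussian, fourierInv_deriv_gaussian, hilbertSymbol_mul_derivSymbol_sq,
      fracSymbol]
    have h2 : |2 * Real.pi * η| ^ (3 : ℝ) = 2 * Real.pi * η * (2 * Real.pi * η)
        * |2 * Real.pi * η| := by
      rw [← abs_mul_abs_self]; norm_num; ring
    rw [h2]
    push_cast
    linear_combination (-(2 * Real.pi * η * (2 * Real.pi * η) * (|2 * Real.pi * η| : ℝ)
      * gaussian η) : ℂ) * Complex.I_sq
  rw [h1]
  exact symbolMoment_frac_gaussian_ne_zero (by norm_num) le_rfl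

/-- An even symbol is paired with an odd transform. With p = 2 this removes the dissipation from the
leading term when a = 1. -/
theorem symbolMoment_frac_deriv_gaussian (p : ℝ) :
    symbolMoment (fracSymbol p) (SchwartzMap.derivCLM ℂ ℂ gaussian) = 0 := by
  unfold symbolMoment
  set h : ℝ → ℂ := fun η => fracSymbol p (2 * Real.pi * η)
    * (𝓕⁻ (SchwartzMap.derivCLM ℂ ℂ gaussian) : 𝓢(ℝ, ℂ)) η with hh
  have h1 : ∀ η, h (-η) = -h η := fun η => by
    simp only [hh, fourierInv_deriv_gaussian, fracSymbol, gaussian_apply, mul_neg, abs_neg,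
      Complex.ofReal_neg, neg_sq]
    ring
  have h2 := integral_neg_eq_self h volume
  simp_rw [h1] at h2
  rw [integral_neg] at h2
  exact self_eq_neg.1 h2.symm

theorem integral_mul_dilate (c : ℝ) (hc : c ≠ 0) (k : 𝓢(ℝ, ℂ)) (f : ℝ → ℂ) :
    ∫ x, f x * dilate (Units.mk0 c hc) k x = ∫ x, f x * k (c * x) := by
  simp only [dilate_apply, Units.val_mk0]

/-! ### Low frequency expansion of the equation. -/

/-- The leading part, as `c → 0+`, of the linear terms of the equation tested against `k (c ·)`. -/
def leadingMoment (α : ℝ) (k : 𝓢(ℝ, ℂ)) (c : ℝ) : ℂ :=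
  ((c ^ (2 : ℝ) : ℝ) : ℂ) * symbolMoment (fun ξ => hilbertSymbol ξ * derivSymbol ξ ^ 2) k
    + ((c ^ α : ℝ) : ℂ) * symbolMoment (fracSymbol α) k

theorem exists_norm_rhs_sub_le {α : ℝ} (hα : α ∈ Set.Icc 0 2) (k : 𝓢(ℝ, ℂ)) {n : ℕ} (hn : n ≤ 2)
    {C : ℝ} (hC : 0 ≤ C) (hk : ∀ y, ‖deriv k y‖ ≤ C * |y| ^ n) (M : ℝ) :
    ∃ K : ℝ, ∀ (f : L2), WeightBound f M → ∀ (c : ℝ) (hc : 0 < c),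
      ‖-(multiplierPairing (fun ξ => hilbertSymbol ξ * derivSymbol ξ ^ 2) f
            (dilate (Units.mk0 c hc.ne') k)
          + multiplierPairing (fracSymbol α) f (dilate (Units.mk0 c hc.ne') k)
          + nonlinearPairing f (dilate (Units.mk0 c hc.ne') k))
        + leadingMoment α k c * ∫ x, f x‖
      ≤ K * (c ^ (2 + 1 / 4 : ℝ) + c ^ (α + 1 / 4) + c ^ ((n : ℝ) + 1)) := by
  set K₁ := massBound M
    * (2 * ∫ η : ℝ, |2 * Real.pi * η| ^ (2 + 1 / 4 : ℝ) * ‖(𝓕⁻ k : 𝓢(ℝ, ℂ)) η‖)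
  set K₂ := massBound M
    * (2 * ∫ η : ℝ, |2 * Real.pi * η| ^ (α + 1 / 4) * ‖(𝓕⁻ k : 𝓢(ℝ, ℂ)) η‖)
  refine ⟨max K₁ (max K₂ (C * M)), fun f hf c hc => ?_⟩
  have h1 := homogeneousSymbol_hilbert.norm_multiplierPairing_sub_le (by norm_num) le_rfl k hf
    (Units.mk0 c hc.ne') hc
  have h2 := (homogeneousSymbol_frac α).norm_multiplierPairing_sub_le hα.1 hα.2 k hf
    (Units.mk0 c hc.ne') hc
  have h3 := hf.norm_nonlinearPairing_le k hn hC hk (Units.mk0 c hc.ne') hc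
  simp only [Units.val_mk0] at h1 h2 h3
  have h4 : (c : ℝ) ^ (n + 1) = c ^ ((n : ℝ) + 1) := by
    rw [← Real.rpow_natCast]; push_cast; rfl
  rw [h4] at h3
  set A := multiplierPairing (fun ξ => hilbertSymbol ξ * derivSymbol ξ ^ 2) f
    (dilate (Units.mk0 c hc.ne') k)
  set B := multiplierPairing (fracSymbol α) f (dilate (Units.mk0 c hc.ne') k)
  set N := nonlinearPairing f (dilate (Units.mk0 c hc.ne') k)
  set I := ∫ x, f x
  set L₁ := symbolMoment (fun ξ => hilbertSymbol ξ * derivSymbol ξ ^ 2) k with hL1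
  set L₂ := symbolMoment (fracSymbol α) k with hL2
  have h5 : -(A + B + N) + leadingMoment α k c * I
      = -((A - ((c ^ (2 : ℝ) : ℝ) : ℂ) * L₁ * I) + (B - ((c ^ α : ℝ) : ℂ) * L₂ * I) + N) := by
    rw [leadingMoment]; ring
  rw [h5, norm_neg]
  calc _ ≤ c ^ (2 + 1 / 4 : ℝ) * K₁ + c ^ (α + 1 / 4) * K₂ + c ^ ((n : ℝ) + 1) * (C * M) :=
        norm_add₃_le.trans (add_le_add (add_le_add h1 h2) h3)
    _ ≤ c ^ (2 + 1 / 4 : ℝ) * max K₁ (max K₂ (C * M)) + c ^ (α + 1 / 4) * max K₁ (max K₂ (C * M))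
        + c ^ ((n : ℝ) + 1) * max K₁ (max K₂ (C * M)) := by
        gcongr
        · exact le_max_left _ _
        · exact (le_max_left _ _).trans (le_max_right _ _)
        · exact (le_max_right _ _).trans (le_max_right _ _)
    _ = _ := by ring

theorem tendsto_leadingMoment {α : ℝ} (hα : 0 < α) (k : 𝓢(ℝ, ℂ)) :
    Tendsto (leadingMoment α k) (𝓝[>] 0) (𝓝 0) := by
  have h : ∀ p : ℝ, 0 < p → Tendsto (fun c : ℝ => ((c ^ p : ℝ) : ℂ)) (𝓝[>] 0) (𝓝 0) :=
    fun p hp => by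
      simpa [Function.comp_def] using (Complex.continuous_ofReal.tendsto 0).comp (tendsto_rpow_nhdsGT_zero hp)
  have := ((h 2 two_pos).mul_const
    (symbolMoment (fun ξ => hilbertSymbol ξ * derivSymbol ξ ^ 2) k)).add
    ((h α hα).mul_const (symbolMoment (fracSymbol α) k))
  simp only [zero_mul, add_zero] at this
  exact this

theorem tendsto_integral_mul_gaussian_dilate {f : ℝ → ℂ} (hf : Integrable f) :
    Tendsto (fun c : ℝ => ∫ x, f x * gaussian (c * x)) (𝓝[>] 0) (𝓝 (∫ x, f x)) := by
  refine tendsto_integral_filter_of_dominated_convergence (fun x => ‖f x‖) ?_ ?_ hf.norm ?_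
  · exact Eventually.of_forall fun c => hf.1.mul
      (gaussian.continuous.comp (by fun_prop)).aestronglyMeasurable
  · refine Eventually.of_forall fun c => Eventually.of_forall fun x => ?_
    rw [norm_mul]
    exact mul_le_of_le_one_right (norm_nonneg _) (norm_gaussian_le_one _)
  · refine Eventually.of_forall fun x => ?_
    have h1 : Tendsto (fun c : ℝ => f x * gaussian (c * x)) (𝓝 0)
        (𝓝 (f x * gaussian (0 * x))) := by
      have : Continuous fun c : ℝ => f x * gaussian (c * x) :=
        continuous_const.mul (gaussian.continuous.comp (by fun_prop))
      exact this.tendsto 0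
    have h2 : gaussian (0 * x) = 1 := by simp [gaussian_apply]
    rw [h2, mul_one] at h1
    exact h1.mono_left nhdsWithin_le_nhds

/-! ### Conservation of mass and its vanishing. -/

section Evolution

variable {α T : ℝ} {φ : L2} {u : ℝ → L2}

/-- Adding zτ to the tested solution shifts its derivative by z, so a derivative close to -z for all
times forces an increment close to -z(t - s). -/
theorem IsSolution.norm_integral_sub_add_le (hsol : IsSolution α T φ u)
    (hc : ContinuousOn u (Set.Icc 0 T)) {k : 𝓢(ℝ, ℂ)} {c R : ℝ} (hc0 : 0 < c) {z : ℂ}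
    (hR : ∀ t ∈ Set.Ioo 0 T,
      ‖-(multiplierPairing (fun ξ => hilbertSymbol ξ * derivSymbol ξ ^ 2) (u t)
            (dilate (Units.mk0 c hc0.ne') k)
          + multiplierPairing (fracSymbol α) (u t) (dilate (Units.mk0 c hc0.ne') k)
          + nonlinearPairing (u t) (dilate (Units.mk0 c hc0.ne') k)) + z‖ ≤ R)
    {s t : ℝ} (hs : s ∈ Set.Icc 0 T) (ht : t ∈ Set.Icc 0 T) :
    ‖(∫ x, u t x * k (c * x)) - (∫ x, u s x * k (c * x)) + z * ((t - s : ℝ) : ℂ)‖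
      ≤ R * |t - s| := by
  have h := norm_sub_le_of_hasDerivAt_Ioo
    (F := fun τ : ℝ => (∫ x, u τ x * dilate (Units.mk0 c hc0.ne') k x) + z * (τ : ℂ))
    (((continuous_integral_mul_schwartz _).comp_continuousOn hc).add (by fun_prop))
    (fun τ hτ => (hsol.2 τ hτ _).add (by
      simpa using ((hasDerivAt_id (τ : ℂ)).const_mul z).comp_ofReal)) hR hs ht
  simp only [integral_mul_dilate] at h
  convert! h using 2
  push_cast
  ring

/-- Conservation of mass. -/
theorem IsSolution.integral_eq (hsol : IsSolution α T φ u) (hα : α ∈ Set.Ioc 0 2)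
    (hc : ContinuousOn u (Set.Icc 0 T)) {M : ℝ} (hM : ∀ t ∈ Set.Icc 0 T, WeightBound (u t) M)
    {s t : ℝ} (hs : s ∈ Set.Icc 0 T) (ht : t ∈ Set.Icc 0 T) :
    ∫ x, u t x = ∫ x, u s x := by
  obtain ⟨C, hC, hk⟩ := norm_deriv_gaussian_le
  obtain ⟨K, hK⟩ := exists_norm_rhs_sub_le ⟨hα.1.le, hα.2⟩ gaussian (n := 0) (by norm_num) hC hk M
  set R : ℝ → ℝ := fun c => K * (c ^ (2 + 1 / 4 : ℝ) + c ^ (α + 1 / 4) + c ^ (((0 : ℕ) : ℝ) + 1))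
    + ‖leadingMoment α gaussian c‖ * massBound M with hR
  have hRlim : Tendsto (fun c => R c * |t - s|) (𝓝[>] 0) (𝓝 0) := by
    have h1 := (((tendsto_rpow_nhdsGT_zero (p := 2 + 1 / 4) (by norm_num)).add
      (tendsto_rpow_nhdsGT_zero (p := α + 1 / 4) (by linarith [hα.1]))).add
      (tendsto_rpow_nhdsGT_zero (p := ((0 : ℕ) : ℝ) + 1) (by norm_num))).const_mul K
    have h2 := ((tendsto_leadingMoment hα.1 gaussian).norm.mul_const (massBound M))
    simpa [hR] using (h1.add h2).mul_const |t - s|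
  have hlim := ((tendsto_integral_mul_gaussian_dilate (hM t ht).integrable_coe).sub
    (tendsto_integral_mul_gaussian_dilate (hM s hs).integrable_coe)).norm
  have h0 : ‖(∫ x, u t x) - ∫ x, u s x‖ ≤ 0 := by
    refine le_of_tendsto_of_tendsto hlim hRlim ?_
    filter_upwards [self_mem_nhdsWithin] with c hc0
    -- No leading term is subtracted here: it tends to 0 itself, so its size is put into R.
    have h1 := hsol.norm_integral_sub_add_le hc (k := gaussian) (R := R c) hc0 (z := 0)
      (fun τ hτ => ?_) hs ht
    · simpa using h1
    · have hτ' := hM τ (Set.Ioo_subset_Icc_self hτ)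
      have h2 := hK (u τ) hτ' c hc0
      rw [add_zero]
      have h3 : ‖leadingMoment α gaussian c * ∫ x, u τ x‖
          ≤ ‖leadingMoment α gaussian c‖ * massBound M := by
        rw [norm_mul]
        gcongr
        exact (norm_integral_le_integral_norm _).trans hτ'.integral_norm_le
      exact (norm_le_norm_add_norm_sub' _ (-(leadingMoment α gaussian c * ∫ x, u τ x))).trans (by
        rw [norm_neg, sub_neg_eq_add, add_comm]
        exact add_le_add h2 h3)
  exact sub_eq_zero.1 (norm_le_zero_iff.1 h0)

/-- If the dilations of `k` detect the leading low frequency behaviour of the equation, but are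
of lower order when tested against the solution at two different times, the mass vanishes. -/
theorem IsSolution.integral_eq_zero_of_tendsto (hsol : IsSolution α T φ u)
    (hα : α ∈ Set.Ioc 0 2) (hc : ContinuousOn u (Set.Icc 0 T)) {M : ℝ}
    (hM : ∀ t ∈ Set.Icc 0 T, WeightBound (u t) M) {s t : ℝ} (hs : s ∈ Set.Icc 0 T)
    (ht : t ∈ Set.Icc 0 T) (hst : s ≠ t) {k : 𝓢(ℝ, ℂ)} {n : ℕ} (hn : n ≤ 2) (hnα : α < n + 1)
    {C : ℝ} (hC : 0 ≤ C) (hk : ∀ y, ‖deriv k y‖ ≤ C * |y| ^ n) {Λ : ℂ} (hΛ : Λ ≠ 0)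
    (hlead : Tendsto (fun c : ℝ => ((c ^ (-α) : ℝ) : ℂ) * leadingMoment α k c) (𝓝[>] 0) (𝓝 Λ))
    (hks : Tendsto (fun c : ℝ => ((c ^ (-α) : ℝ) : ℂ) * ∫ x : ℝ, u s x * k (c * x))
      (𝓝[>] 0) (𝓝 0))
    (hkt : Tendsto (fun c : ℝ => ((c ^ (-α) : ℝ) : ℂ) * ∫ x : ℝ, u t x * k (c * x))
      (𝓝[>] 0) (𝓝 0)) :
    ∫ x, u s x = 0 := by
  obtain ⟨K, hK⟩ := exists_norm_rhs_sub_le ⟨hα.1.le, hα.2⟩ k hn hC hk M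
  set J := ∫ x, u s x with hJ
  have hlim := ((hkt.sub hks).add (hlead.mul_const (J * ((t - s : ℝ) : ℂ)))).norm
  -- All three exponents stay positive after division by c^α: the first since α ≤ 2, the last since
  -- α < n + 1.
  have hRlim : Tendsto (fun c : ℝ => K * (c ^ ((2 + 1 / 4 : ℝ) - α) + c ^ (α + 1 / 4 - α)
      + c ^ ((n : ℝ) + 1 - α)) * |t - s|) (𝓝[>] 0) (𝓝 0) := by
    have h1 := (((tendsto_rpow_nhdsGT_zero (p := 2 + 1 / 4 - α) (by linarith [hα.2])).add
      (tendsto_rpow_nhdsGT_zero (p := α + 1 / 4 - α) (by linarith))).add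
      (tendsto_rpow_nhdsGT_zero (p := (n : ℝ) + 1 - α) (by linarith))).const_mul K
    simpa using h1.mul_const |t - s|
  have h0 : ‖(0 : ℂ) - 0 + Λ * (J * ((t - s : ℝ) : ℂ))‖ ≤ 0 := by
    refine le_of_tendsto_of_tendsto hlim hRlim ?_
    filter_upwards [self_mem_nhdsWithin] with c (hc0 : 0 < c)
    have h1 := hsol.norm_integral_sub_add_le hc (k := k) hc0 (z := leadingMoment α k c * J)
      (fun τ hτ => by
        have hτ' := Set.Ioo_subset_Icc_self hτ
        have h2 := hK (u τ) (hM τ hτ') c hc0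
        -- Conservation of mass makes the leading term the same at every time, as the constant z
        -- requires.
        rwa [hsol.integral_eq hα hc hM hs hτ'] at h2) hs ht
    have h2 : ((c ^ (-α) : ℝ) : ℂ) * (∫ x : ℝ, u t x * k (c * x))
        - ((c ^ (-α) : ℝ) : ℂ) * (∫ x : ℝ, u s x * k (c * x))
        + ((c ^ (-α) : ℝ) : ℂ) * leadingMoment α k c * (J * ((t - s : ℝ) : ℂ))
        = ((c ^ (-α) : ℝ) : ℂ) * ((∫ x, u t x * k (c * x)) - (∫ x, u s x * k (c * x))
          + leadingMoment α k c * J * ((t - s : ℝ) : ℂ)) := by ring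
    rw [h2, norm_mul, Complex.norm_real, Real.norm_of_nonneg (by positivity)]
    calc _ ≤ c ^ (-α) * (K * (c ^ (2 + 1 / 4 : ℝ) + c ^ (α + 1 / 4) + c ^ ((n : ℝ) + 1))
          * |t - s|) := by gcongr
      _ = _ := by
        simp only [sub_eq_add_neg _ α, Real.rpow_add hc0]
        ring
  have h1 := norm_le_zero_iff.1 h0
  rw [sub_zero, zero_add] at h1
  have h2 : ((t - s : ℝ) : ℂ) ≠ 0 := by exact_mod_cast sub_ne_zero.2 hst.symm
  exact ((mul_eq_zero.1 ((mul_eq_zero.1 h1).resolve_left hΛ))).resolve_right h2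

end Evolution

/-! ### Limits of the leading moments, and the conclusion. -/

theorem tendsto_rpow_neg_mul_leadingMoment_evenKernel {α : ℝ} (hα : α ∈ Set.Ioo 0 2) :
    Tendsto (fun c : ℝ => ((c ^ (-α) : ℝ) : ℂ) * leadingMoment α evenKernel c) (𝓝[>] 0)
      (𝓝 (symbolMoment (fracSymbol α) evenKernel)) := by
  have h1 : Tendsto (fun c : ℝ => ((c ^ (2 - α) : ℝ) : ℂ)
      * symbolMoment (fun ξ => hilbertSymbol ξ * derivSymbol ξ ^ 2) evenKernel
      + symbolMoment (fracSymbol α) evenKernel) (𝓝[>] 0)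
      (𝓝 (symbolMoment (fracSymbol α) evenKernel)) := by
    have h := (Complex.continuous_ofReal.tendsto 0).comp
      (tendsto_rpow_nhdsGT_zero (p := 2 - α) (by linarith [hα.2]))
    simpa using (h.mul_const _).add_const (symbolMoment (fracSymbol α) evenKernel)
  refine h1.congr' ?_
  filter_upwards [self_mem_nhdsWithin] with c (hc : 0 < c)
  have e1 : c ^ (-α) * c ^ α = 1 := by rw [← Real.rpow_add hc]; simp
  have e2 : c ^ (2 - α) = c ^ (-α) * c ^ (2 : ℝ) := by rw [← Real.rpow_add hc]; ring_nf
  have e1' : ((c ^ (-α) : ℝ) : ℂ) * ((c ^ α : ℝ) : ℂ) = 1 := by exact_mod_cast e1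
  rw [leadingMoment, e2, Complex.ofReal_mul]
  linear_combination (-symbolMoment (fracSymbol α) evenKernel) * e1'

theorem tendsto_rpow_neg_mul_leadingMoment_oddKernel :
    Tendsto (fun c : ℝ => ((c ^ (-2 : ℝ) : ℝ) : ℂ) * leadingMoment 2 oddKernel c) (𝓝[>] 0)
      (𝓝 (symbolMoment (fun ξ => hilbertSymbol ξ * derivSymbol ξ ^ 2) oddKernel)) := by
  have h0 : symbolMoment (fracSymbol 2) oddKernel = 0 := by
    rw [(homogeneousSymbol_frac 2).symbolMoment_oddKernel, symbolMoment_frac_deriv_gaussian,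
      mul_zero]
  refine tendsto_const_nhds.congr' ?_
  filter_upwards [self_mem_nhdsWithin] with c (hc : 0 < c)
  have e1 : c ^ (-2 : ℝ) * c ^ (2 : ℝ) = 1 := by rw [← Real.rpow_add hc]; simp
  have e1' : ((c ^ (-2 : ℝ) : ℝ) : ℂ) * ((c ^ (2 : ℝ) : ℝ) : ℂ) = 1 := by exact_mod_cast e1
  rw [leadingMoment, h0, mul_zero, add_zero, ← mul_assoc, e1', one_mul]

end DBO

end

theorem theorem1p2 (a T : ℝ) (ha : a ∈ Set.Ioc (0 : ℝ) 1) (φ : DBO.L2) (u : ℝ → DBO.L2)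
    (hu : DBO.ContinuousInZ 1 1 T u) (hsol : DBO.IsSolution (1 + a) T φ u)
    (t₁ t₂ : ℝ) (ht₁ : t₁ ∈ Set.Icc 0 T) (ht₂ : t₂ ∈ Set.Icc 0 T) (hne : t₁ ≠ t₂)
    (h₁ : u t₁ ∈ DBO.Z (3 / 2 + a) (3 / 2 + a)) (h₂ : u t₂ ∈ DBO.Z (3 / 2 + a) (3 / 2 + a)) :
    ∀ t ∈ Set.Icc 0 T,
      Integrable (u t : ℝ → ℂ) ∧ DBO.fourierAt (u t) 0 = 0 := by
  obtain ⟨M, hM⟩ := hu.exists_weightBound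
  have hc := hu.continuousOn zero_le_one
  have hα : 1 + a ∈ Set.Ioc (0 : ℝ) 2 := ⟨by linarith [ha.1], by linarith [ha.2]⟩
  -- The assumed weight is exactly the critical α + 1/2 with α = 1 + a.
  have he : 3 / 2 + a = 1 + a + 1 / 2 := by ring
  have hw₁ := h₁.2
  have hw₂ := h₂.2
  rw [he] at hw₁ hw₂
  have hzero : ∫ x, u t₁ x = 0 := by
    rcases ha.2.lt_or_eq with ha1 | rfl
    · obtain ⟨D, hD⟩ := DBO.exists_norm_le DBO.evenKernel
      have hk : ∀ y, ‖DBO.evenKernel y‖ ≤ Real.pi * |y| ^ (2 : ℝ) := fun y => by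
        rw [Real.rpow_ofNat]; exact DBO.norm_evenKernel_le y
      -- The nonlinear error is O(c²), negligible against c^α because α < 2.
      refine hsol.integral_eq_zero_of_tendsto hα hc hM ht₁ ht₂ hne (n := 1) (by norm_num)
        (by push_cast; linarith) (by positivity) DBO.norm_deriv_evenKernel_le ?_
        (DBO.tendsto_rpow_neg_mul_leadingMoment_evenKernel ⟨hα.1, by linarith⟩)
        (DBO.tendsto_integral_mul_dilate_div_rpow DBO.evenKernel.continuous hα.1 (by linarith)
          hk hD hw₁)
        (DBO.tendsto_integral_mul_dilate_div_rpow DBO.evenKernel.continuous hα.1 (by linarith)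
          hk hD hw₂)
      rw [(DBO.homogeneousSymbol_frac _).symbolMoment_evenKernel hα.1.le (by linarith [hα.2])]
      refine mul_ne_zero ?_
        (DBO.symbolMoment_frac_gaussian_ne_zero hα.1.le (by linarith [hα.2]))
      have := Real.rpow_lt_one (x := 1 / 2) (by norm_num) (by norm_num) hα.1
      rw [sub_ne_zero]
      exact_mod_cast this.ne'
    · obtain ⟨D, hD⟩ := DBO.exists_norm_le DBO.oddKernel
      have hk : ∀ y, ‖DBO.oddKernel y‖ ≤ 2 * Real.pi ^ 2 * |y| ^ (3 : ℝ) := fun y => by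
        rw [Real.rpow_ofNat]; exact DBO.norm_oddKernel_le y
      rw [one_add_one_eq_two] at *
      -- Now α = 2, and the nonlinear error must be O(c³), so k' has to vanish to order 2.
      refine hsol.integral_eq_zero_of_tendsto hα hc hM ht₁ ht₂ hne (n := 2) le_rfl
        (by norm_num) (by positivity) DBO.norm_deriv_oddKernel_le ?_
        DBO.tendsto_rpow_neg_mul_leadingMoment_oddKernel
        (DBO.tendsto_integral_mul_dilate_div_rpow DBO.oddKernel.continuous hα.1 (by norm_num)
          hk hD hw₁)
        (DBO.tendsto_integral_mul_dilate_div_rpow DBO.oddKernel.continuous hα.1 (by norm_num)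
          hk hD hw₂)
      rw [DBO.homogeneousSymbol_hilbert.symbolMoment_oddKernel]
      exact mul_ne_zero (by norm_num) DBO.symbolMoment_hilbert_deriv_gaussian_ne_zero
  intro t ht
  refine ⟨(hM t ht).integrable_coe, ?_⟩
  have h := hsol.integral_eq hα hc hM ht₁ ht
  rw [hzero] at h
  simpa [DBO.fourierAt] using h
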